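/- Let $G=(T\cup B,E)$ be a finite simple bipartite graph with $m=|E|$ edges, and let $k\ge 0$ be an integer. A planar 2-layered drawing of a bipartite graph with layers $T$ and $B$ places the vertices of $T$ at distinct integer points of the line $y=1$ and the vertices of $B$ at distinct integer points of the line $y=0$, and draws the edges as straight-line segments so that two distinct edges meet only in a common end-vertex. To split a vertex $u$ is to replace it by two copies and to distribute the edges at $u$ between the two copies; copies may be split again. The problem CRSV$(k)$ asks whether one can split at most $k$ vertices of $B$ (each of them arbitrarily many times) so that the resulting bipartite graph has a planar 2-layered drawing. There is a deterministic algorithm that, given $G$ (by a list of its edges) and $k$, decides CRSV$(k)$ for $G$ in time $2^{O(k^6)}\cdot m$ on a word RAM with words of $O(\log(|T|+|B|+m+k))$ bits; that is, there is an absolute constant $C$ such that the algorithm makes at most $C\cdot 2^{Ck^6}\cdot (m+1)$ steps. In particular, CRSV is fixed-parameter tractable in $k$. -/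

import Mathlib

namespace BipartiteSplit

/-! ### Bipartite graphs, 2-layered drawings, vertex splitting

A bipartite graph with top layer `T` and bottom layer `B` is given by its set of edges, a subset of
`T × B`. -/

/-- The straight-line edge from the point `x` of the line with ordinate `1` to the point `y` of the
line with ordinate `0`. -/
def edgeSegment (x y : ℤ) : Set (ℝ × ℝ) :=
  segment ℝ ((x : ℝ), (1 : ℝ)) ((y : ℝ), (0 : ℝ))

/-- `G` has a planar 2-layered drawing: the vertices of `T` are put at distinct integer points of the
line with ordinate `1`, those of `B` at distinct integer points of the line with ordinate `0`, and any
two distinct edges, drawn as straight-line segments, meet only in a common end-vertex. -/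
def HasPlanarDrawing {T B : Type} (G : Set (T × B)) : Prop :=
  ∃ (x : T → ℤ) (y : B → ℤ), Function.Injective x ∧ Function.Injective y ∧
    ∀ e ∈ G, ∀ f ∈ G, e ≠ f →
      ∀ p ∈ edgeSegment (x e.1) (y e.2) ∩ edgeSegment (x f.1) (y f.2),
        (e.1 = f.1 ∧ p = ((x e.1 : ℝ), (1 : ℝ))) ∨ (e.2 = f.2 ∧ p = ((y e.2 : ℝ), (0 : ℝ)))

/-- One split operation at the bottom vertex `u`: `u` is replaced by the two copies `some u` and
`none`; the edges from `u` to `S` go to the copy `none`, the other edges at `u` to the copy `some u`.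
Every other vertex `b`, now called `some b`, keeps its edges. -/
def splitVertex {T B : Type} (G : Set (T × B)) (u : B) (S : Set T) : Set (T × Option B) :=
  {e | (∃ b, e.2 = some b ∧ (e.1, b) ∈ G ∧ (b = u → e.1 ∉ S)) ∨
       (e.2 = none ∧ (e.1, u) ∈ G ∧ e.1 ∈ S)}

/-- `SplitsInto G X G' o`: the graph `G'` arises from `G` by a finite sequence of split operations,
each at (a copy of) a vertex in `X`; the map `o` sends every bottom vertex of `G'` to the vertex of `G`
of which it is a copy. Every vertex in `X` may be split any number of times. -/
inductive SplitsInto {T B : Type} (G : Set (T × B)) (X : Set B) :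
    ∀ {B' : Type}, Set (T × B') → (B' → B) → Prop
  | refl : SplitsInto G X G id
  | split {B' : Type} {G' : Set (T × B')} {o : B' → B} (h : SplitsInto G X G' o)
      (u : B') (hu : o u ∈ X) (S : Set T) :
      SplitsInto G X (splitVertex G' u S) (fun c => o (c.getD u))

/-- The problem CRSV(`k`): `G` has a planar 2-layered drawing after splitting at most `k` vertices
of `B`. -/
def CRSV {T B : Type} (G : Set (T × B)) (k : ℕ) : Prop :=
  ∃ X : Finset B, X.card ≤ k ∧
    ∃ (B' : Type) (G' : Set (T × B')) (o : B' → B),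
      SplitsInto G (X : Set B) G' o ∧ HasPlanarDrawing G'

/-! ### The machine model: a word RAM with structured programs -/

/-- A memory state: registers and arrays, all holding natural numbers. (`arr A i` is cell `i` of
array `A`; a program mentions only finitely many registers and arrays.) -/
structure State where
  reg : ℕ → ℕ
  arr : ℕ → ℕ → ℕ

/-- `x := v`. -/
def State.setReg (s : State) (x v : ℕ) : State :=
  { s with reg := Function.update s.reg x v }

/-- `A[i] := v`. -/
def State.setCell (s : State) (A i v : ℕ) : State :=
  { s with arr := Function.update s.arr A (Function.update (s.arr A) i v) }

/-- The arithmetic instructions (subtraction is truncated at `0`, division rounds down). -/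
inductive Op
  | add | sub | mul | div

def Op.eval : Op → ℕ → ℕ → ℕ
  | .add, m, n => m + n
  | .sub, m, n => m - n
  | .mul, m, n => m * n
  | .div, m, n => m / n

/-- Programs. Registers (`x`, `y`, `z`) and arrays (`A`) are referred to by number. -/
inductive Prog
  /-- do nothing -/
  | skip
  /-- `x := c` for a constant `c` -/
  | const (x c : ℕ)
  /-- `x := y o z` -/
  | op (o : Op) (x y z : ℕ)
  /-- `x := A[y]` -/
  | load (x A y : ℕ)
  /-- `A[x] := y` -/
  | store (A x y : ℕ)
  /-- `p; q` -/
  | seq (p q : Prog)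
  /-- `if x < y then p else q` -/
  | ifLt (x y : ℕ) (p q : Prog)
  /-- `while x < y do p` -/
  | whileLt (x y : ℕ) (p : Prog)

/-- `Exec W p s t s'`: started in state `s`, the program `p` halts in state `s'` after exactly `t`
steps, and every number written on the way is less than `W` (an overflow blocks the execution, so that
`W` is the number of values of a machine word). Every executed instruction and every evaluated test
counts as one step. -/
inductive Exec (W : ℕ) : Prog → State → ℕ → State → Prop
  | skip (s : State) : Exec W .skip s 1 s
  | const (s : State) (x c : ℕ) (h : c < W) : Exec W (.const x c) s 1 (s.setReg x c)
  | op (s : State) (o : Op) (x y z : ℕ) (h : o.eval (s.reg y) (s.reg z) < W) :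
      Exec W (.op o x y z) s 1 (s.setReg x (o.eval (s.reg y) (s.reg z)))
  | load (s : State) (x A y : ℕ) (h : s.arr A (s.reg y) < W) :
      Exec W (.load x A y) s 1 (s.setReg x (s.arr A (s.reg y)))
  | store (s : State) (A x y : ℕ) (h : s.reg x < W ∧ s.reg y < W) :
      Exec W (.store A x y) s 1 (s.setCell A (s.reg x) (s.reg y))
  | seq {p q : Prog} {s s₁ s₂ : State} {t₁ t₂ : ℕ}
      (hp : Exec W p s t₁ s₁) (hq : Exec W q s₁ t₂ s₂) : Exec W (.seq p q) s (t₁ + t₂) s₂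
  | ifTrue {p q : Prog} {s s' : State} {t : ℕ} (x y : ℕ) (h : s.reg x < s.reg y)
      (hp : Exec W p s t s') : Exec W (.ifLt x y p q) s (t + 1) s'
  | ifFalse {p q : Prog} {s s' : State} {t : ℕ} (x y : ℕ) (h : ¬ s.reg x < s.reg y)
      (hq : Exec W q s t s') : Exec W (.ifLt x y p q) s (t + 1) s'
  | whileFalse {p : Prog} {s : State} (x y : ℕ) (h : ¬ s.reg x < s.reg y) :
      Exec W (.whileLt x y p) s 1 s
  | whileTrue {p : Prog} {s s₁ s₂ : State} {t₁ t₂ : ℕ} (x y : ℕ) (h : s.reg x < s.reg y)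
      (hp : Exec W p s t₁ s₁) (hw : Exec W (.whileLt x y p) s₁ t₂ s₂) :
      Exec W (.whileLt x y p) s (t₁ + t₂ + 1) s₂

/-- The machine is deterministic. -/
theorem Exec.deterministic {W : ℕ} {p : Prog} {s s₁ s₂ : State} {t₁ t₂ : ℕ}
    (h₁ : Exec W p s t₁ s₁) (h₂ : Exec W p s t₂ s₂) : t₁ = t₂ ∧ s₁ = s₂ := by
  induction h₁ generalizing t₂ s₂ with
  | skip => cases h₂; exact ⟨rfl, rfl⟩
  | const => cases h₂; exact ⟨rfl, rfl⟩
  | op => cases h₂; exact ⟨rfl, rfl⟩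
  | load => cases h₂; exact ⟨rfl, rfl⟩
  | store => cases h₂; exact ⟨rfl, rfl⟩
  | seq _ _ ihp ihq =>
    cases h₂ with
    | seq hp hq =>
      obtain ⟨rfl, rfl⟩ := ihp hp
      obtain ⟨rfl, rfl⟩ := ihq hq
      exact ⟨rfl, rfl⟩
  | ifTrue x y h _ ih =>
    cases h₂ with
    | ifTrue _ _ _ hp => obtain ⟨rfl, rfl⟩ := ih hp; exact ⟨rfl, rfl⟩
    | ifFalse _ _ h' _ => exact absurd h h'
  | ifFalse x y h _ ih =>
    cases h₂ with
    | ifTrue _ _ h' _ => exact absurd h' h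
    | ifFalse _ _ _ hp => obtain ⟨rfl, rfl⟩ := ih hp; exact ⟨rfl, rfl⟩
  | whileFalse x y h =>
    cases h₂ with
    | whileFalse => exact ⟨rfl, rfl⟩
    | whileTrue _ _ h' _ _ => exact absurd h' h
  | whileTrue x y h _ _ ihp ihw =>
    cases h₂ with
    | whileFalse _ _ h' => exact absurd h h'
    | whileTrue _ _ _ hp hw =>
      obtain ⟨rfl, rfl⟩ := ihp hp
      obtain ⟨rfl, rfl⟩ := ihw hw
      exact ⟨rfl, rfl⟩

/-- The initial state for a graph with top vertices `0, …, a - 1`, bottom vertices `0, …, b - 1` and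
edge list `l`, and for the parameter `k`: registers `0`, `1`, `2`, `3` hold `a`, `b`, the number of
edges, and `k`; cell `i` of array `0` holds the top end and cell `i` of array `1` the bottom end of the
`i`-th edge; all other registers and cells hold `0`. -/
def inputState {a b : ℕ} (l : List (Fin a × Fin b)) (k : ℕ) : State where
  reg
    | 0 => a
    | 1 => b
    | 2 => l.length
    | 3 => k
    | _ => 0
  arr
    | 0 => fun i => (l.map fun e => (e.1 : ℕ)).getD i 0
    | 1 => fun i => (l.map fun e => (e.2 : ℕ)).getD i 0
    | _ => fun _ => 0

end BipartiteSplit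

set_option linter.unusedSimpArgs false

namespace BipartiteSplit

/-! ### Planar drawings and full splittings -/

/-! A planar 2-layered drawing exists iff both layers can be ordered so that edges with strictly
increasing top ends have weakly increasing bottom ends (`hasPlanarDrawing_iff`). Splitting every
vertex of the chosen set `X` completely, into copies of degree at most one, is the best that can be
done. The graph that results is drawable iff it is a forest of caterpillars, that is, iff the edges
between its non-leaves form a linear forest. These are the active edges: both ends have degree at
least two in the input graph and the bottom end is outside `X`. So CRSV asks for at most `k`
vertices `X` for which the active edges form a linear forest (`EdgeList.crsv_iff`).

This is a hitting problem with small obstructions. If three active edges meet at a top vertex, one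
of their three bottom ends must enter `X`; if they meet at a bottom vertex, that vertex must. Once
all active degrees are at most two, the only remaining obstructions are components that are cycles.
Distinct cycles are disjoint and each must be hit, so an exchange argument allows any prescribed
bottom vertex of the cycle to be chosen (`conflict_cycle`). Each obstruction thus offers at most
three choices and uses up one unit of the budget: a search tree with `3 ^ k` leaves is enough
(`exists_accepts_iff`).

An obstruction is found in linear time. One pass counts active degrees and remembers two neighbours
of each top vertex; a second pass grows paths, storing at each path end the opposite end, and
reports the edge that closes a cycle. The program runs through all ternary strings of length `k` as
sequences of choices and makes `k + 1` scans for each, in total `O(3 ^ k * (k + 1) * (m + 1))`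
steps, well within the required bound. Its correctness is proved by weakest preconditions for
loop-free code, with invariants for the loops. -/

theorem mem_edgeSegment {x y : ℤ} {p : ℝ × ℝ} :
    p ∈ edgeSegment x y ↔ 0 ≤ p.2 ∧ p.2 ≤ 1 ∧ p.1 = p.2 * x + (1 - p.2) * y := by
  constructor
  · rintro ⟨α, β, hα, hβ, hαβ, rfl⟩
    obtain rfl : β = 1 - α := by linarith
    simp
    exact ⟨hα, by linarith⟩
  · rintro ⟨h0, h1, h⟩
    refine ⟨p.2, 1 - p.2, h0, by linarith, by ring, ?_⟩
    ext <;> simp [h]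

/-- A bipartite graph has a planar 2-layered drawing iff its vertices can be ordered monotonically. -/
theorem hasPlanarDrawing_iff {T B : Type} {G : Set (T × B)} :
    HasPlanarDrawing G ↔ ∃ (x : T → ℤ) (y : B → ℤ), Function.Injective x ∧ Function.Injective y ∧
      ∀ e ∈ G, ∀ f ∈ G, x e.1 < x f.1 → y e.2 ≤ y f.2 := by
  constructor
  · rintro ⟨x, y, hx, hy, h⟩
    refine ⟨x, y, hx, hy, fun e he f hf hlt => ?_⟩
    by_contra! hc
    have h1 : (x e.1 : ℝ) < x f.1 := by exact_mod_cast hlt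
    have h2 : (y f.2 : ℝ) < y e.2 := by exact_mod_cast hc
    have hD : (0 : ℝ) < (x f.1 - x e.1) + (y e.2 - y f.2) := by linarith
    -- `α` is the height at which the two segments cross; it lies strictly between the layers, so
    -- the crossing is not an end-vertex.
    set α : ℝ := (y e.2 - y f.2) / ((x f.1 - x e.1) + (y e.2 - y f.2)) with hα
    have hα0 : 0 < α := div_pos (by linarith) hD
    have hα1 : α < 1 := (div_lt_one hD).2 (by linarith)
    have hαe : α * ((x f.1 - x e.1) + (y e.2 - y f.2)) = y e.2 - y f.2 :=
      div_mul_cancel₀ _ hD.ne'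
    have hne : e ≠ f := by rintro rfl; exact lt_irrefl _ hlt
    rcases h e he f hf hne (α * x e.1 + (1 - α) * y e.2, α)
      ⟨mem_edgeSegment.2 ⟨hα0.le, hα1.le, rfl⟩,
        mem_edgeSegment.2 ⟨hα0.le, hα1.le, by simp only; linarith⟩⟩ with h' | h'
    · have := congrArg Prod.snd h'.2
      simp only at this
      linarith
    · have := congrArg Prod.snd h'.2
      simp only at this
      linarith
  · rintro ⟨x, y, hx, hy, h⟩
    -- At positive height the edge with the larger top end is strictly to the right, so the two can
    -- meet only on the bottom line.
    have key : ∀ e ∈ G, ∀ f ∈ G, e.1 ≠ f.1 → x e.1 < x f.1 →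
        ∀ p ∈ edgeSegment (x e.1) (y e.2) ∩ edgeSegment (x f.1) (y f.2),
        e.2 = f.2 ∧ p = ((y e.2 : ℝ), (0 : ℝ)) := by
      rintro e he f hf hne hlt p ⟨hp1, hp2⟩
      obtain ⟨h0, h1, h2⟩ := mem_edgeSegment.1 hp1
      obtain ⟨-, -, h3⟩ := mem_edgeSegment.1 hp2
      have hx' : (x e.1 : ℝ) < x f.1 := by exact_mod_cast hlt
      have hy' : (y e.2 : ℝ) ≤ y f.2 := by exact_mod_cast h e he f hf hlt
      have hp0 : p.2 = 0 := by
        by_contra hc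
        have : 0 < p.2 := lt_of_le_of_ne h0 (Ne.symm hc)
        nlinarith [mul_pos this (sub_pos.2 hx'), mul_nonneg (sub_nonneg.2 h1) (sub_nonneg.2 hy')]
      rw [hp0] at h2 h3
      refine ⟨hy ?_, Prod.ext (by simp [h2]) hp0⟩
      have : (y e.2 : ℝ) = y f.2 := by linarith
      exact_mod_cast this
    refine ⟨x, y, hx, hy, fun e he f hf hne p hp => ?_⟩
    by_cases h1 : e.1 = f.1
    · refine Or.inl ⟨h1, ?_⟩
      have h2 : e.2 ≠ f.2 := fun h2 => hne (Prod.ext h1 h2)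
      obtain ⟨-, -, h3⟩ := mem_edgeSegment.1 hp.1
      obtain ⟨-, -, h4⟩ := mem_edgeSegment.1 hp.2
      have hy' : (y e.2 : ℝ) - y f.2 ≠ 0 := by
        rw [sub_ne_zero]
        exact fun h => h2 (hy (by exact_mod_cast h))
      rw [← h1] at h4
      have : (1 - p.2) * ((y e.2 : ℝ) - y f.2) = 0 := by linarith
      have hp1 : p.2 = 1 := by
        rcases mul_eq_zero.1 this with h | h
        · linarith
        · exact absurd h hy'
      rw [hp1] at h3
      exact Prod.ext (by simp [h3]) hp1
    · refine Or.inr ?_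
      rcases lt_or_gt_of_ne (fun h => h1 (hx h)) with hlt | hlt
      · exact key e he f hf h1 hlt p hp
      · have := key f hf e he (Ne.symm h1) hlt p hp.symm
        exact ⟨this.1.symm, by rw [this.2, this.1]⟩

/-! ### Copies of vertices and edges under repeated splitting -/

namespace SplitsInto

variable {T B B' : Type} {G : Set (T × B)} {X : Set B} {G' : Set (T × B')} {o : B' → B}

theorem finite [Finite B] (h : SplitsInto G X G' o) : Finite B' := by
  induction h with
  | refl => assumption
  | split _ _ _ _ ih => infer_instance

theorem mem (h : SplitsInto G X G' o) : ∀ t c, (t, c) ∈ G' → (t, o c) ∈ G := by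
  induction h with
  | refl => exact fun _ _ h => h
  | split h u hu S ih =>
    rintro t c (⟨b, hb, h1, -⟩ | ⟨hb, h1, -⟩) <;> simp only at hb h1 <;> subst hb
    · exact ih _ _ h1
    · exact ih _ _ h1

theorem exists_copy (h : SplitsInto G X G' o) : ∀ t b, (t, b) ∈ G → ∃ c, o c = b ∧ (t, c) ∈ G' := by
  induction h with
  | refl => exact fun _ b h => ⟨b, rfl, h⟩
  | split h u hu S ih =>
    intro t b htb
    obtain ⟨c, hc, hm⟩ := ih t b htb
    by_cases hS : c = u ∧ t ∈ S
    · exact ⟨none, by simp [← hc, hS.1], Or.inr ⟨rfl, hS.1 ▸ hm, hS.2⟩⟩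
    · exact ⟨some c, by simp [hc], Or.inl ⟨c, rfl, hm, fun h1 h2 => hS ⟨h1, h2⟩⟩⟩

theorem copy_unique (h : SplitsInto G X G' o) : ∀ c d, o c = o d → o c ∉ X → c = d := by
  induction h with
  | refl => exact fun _ _ h _ => h
  | @split B' G' o h u hu S ih =>
    have hne : ∀ c, o c ∉ X → c ≠ u := by rintro c hc rfl; exact hc hu
    rintro (_ | c) (_ | d) hcd hX
    · rfl
    · exact absurd hu hX
    · simp only [Option.getD_some, Option.getD_none] at hcd hX
      exact absurd (hcd ▸ hu) hX
    · exact congrArg some (ih c d hcd hX)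

/-- A split distributes the edges among the two copies without duplicating any, so each edge
survives at exactly one copy. -/
theorem edge_unique (h : SplitsInto G X G' o) :
    ∀ t c d, (t, c) ∈ G' → (t, d) ∈ G' → o c = o d → c = d := by
  induction h with
  | refl => exact fun _ _ _ _ _ h => h
  | @split B' G' o h u hu S ih =>
    rintro t c d (⟨b, hb, h1, h2⟩ | ⟨hb, h1, h2⟩) (⟨b', hb', h1', h2'⟩ | ⟨hb', h1', h2'⟩) hcd <;>
      simp only at * <;> subst hb <;> subst hb' <;> simp only [Option.getD_some, Option.getD_none] at hcd
    · exact congrArg some (ih _ _ _ h1 h1' hcd)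
    · exact absurd h2' (h2 (ih _ _ _ h1 h1' hcd))
    · exact absurd h2 (h2' (ih _ _ _ h1 h1' hcd).symm)
    · rfl

/-- The edges in a finite set `D` at vertices of `X` can be split off one by one. -/
theorem exists_split_off [DecidableEq T] [DecidableEq B] (G : Set (T × B)) (X : Set B)
    (D : Finset (T × B)) (hD : ∀ e ∈ D, e.2 ∈ X) :
    ∃ (B' : Type) (G' : Set (T × B')) (o : B' → B), SplitsInto G X G' o ∧
      ∀ t c t', (t, o c) ∈ D → (t, c) ∈ G' → (t', c) ∈ G' → t' = t := by
  induction D using Finset.induction_on with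
  | empty => exact ⟨B, G, id, .refl, by simp⟩
  | insert e D he ih =>
    obtain ⟨B', G', o, hs, h⟩ := ih fun e he => hD e (Finset.mem_insert_of_mem he)
    obtain ⟨t₀, b₀⟩ := e
    by_cases hex : ∃ c, o c = b₀ ∧ (t₀, c) ∈ G'
    · obtain ⟨u, rfl, hu⟩ := hex
      -- Only the edge to `t₀` moves to the new copy, which therefore has degree one. By
      -- `edge_unique` no other copy of the same vertex carries this edge.
      refine ⟨_, _, _, hs.split u (hD (t₀, o u) (Finset.mem_insert_self _ _)) {t₀}, ?_⟩
      rintro t (_ | c) t' hm h1 h2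
      · simp [splitVertex] at h1 h2
        rw [h1.2, h2.2]
      · simp [splitVertex] at h1 h2 hm
        rcases hm with ⟨rfl, hm⟩ | hm
        · exact absurd rfl (h1.2 (hs.edge_unique _ _ _ h1.1 hu hm))
        · exact h _ _ _ hm h1.1 h2.1
    · refine ⟨B', G', o, hs, fun t c t' hm h1 h2 => ?_⟩
      rcases Finset.mem_insert.1 hm with hm | hm
      · obtain ⟨rfl, rfl⟩ := Prod.mk.inj hm
        exact absurd ⟨c, rfl, h1⟩ hex
      · exact h _ _ _ hm h1 h2

/-- The vertices of `X` can be split into copies of degree at most one. -/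
theorem exists_full [Finite T] [Finite B] (G : Set (T × B)) (X : Set B) :
    ∃ (B' : Type) (G' : Set (T × B')) (o : B' → B), SplitsInto G X G' o ∧
      ∀ t c t', o c ∈ X → (t, c) ∈ G' → (t', c) ∈ G' → t' = t := by
  classical
  have hfin : {e : T × B | e.2 ∈ X}.Finite := Set.toFinite _
  obtain ⟨B', G', o, hs, h⟩ := exists_split_off G X hfin.toFinset (by simp)
  exact ⟨B', G', o, hs, fun t c t' hX => h t c t' (by simpa using hX)⟩

end SplitsInto

end BipartiteSplit

namespace BipartiteSplit

/-! ### Edge lists and linear forests -/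

/-- The edges of a bipartite graph, as a list of pairs of distinct numbered vertices. -/
structure EdgeList where
  m : ℕ
  top : ℕ → ℕ
  bot : ℕ → ℕ
  disj : ∀ i j, i < m → j < m → top i ≠ bot j
  inj : ∀ i j, i < m → j < m → top i = top j → bot i = bot j → i = j

namespace EdgeList

variable (I : EdgeList)

/-- The `i`-th edge is incident with `u`. -/
def Inc (u i : ℕ) : Prop := I.top i = u ∨ I.bot i = u

instance (u i : ℕ) : Decidable (I.Inc u i) := inferInstanceAs (Decidable (_ ∨ _))

/-- The degree of `u`. -/
def deg (u : ℕ) : ℕ := ((Finset.range I.m).filter (I.Inc u)).card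

/-- An edge is active if its ends have degree at least two and its bottom end is not in `X`. -/
def Act (X : Finset ℕ) (i : ℕ) : Prop :=
  2 ≤ I.deg (I.top i) ∧ 2 ≤ I.deg (I.bot i) ∧ I.bot i ∉ X

instance (X : Finset ℕ) (i : ℕ) : Decidable (I.Act X i) := inferInstanceAs (Decidable (_ ∧ _))

/-- The number of active edges at `u` among the first `j` edges. -/
def adeg (X : Finset ℕ) (j u : ℕ) : ℕ :=
  ((Finset.range j).filter fun i => I.Act X i ∧ I.Inc u i).card

/-- No active edge among the first `j` edges leaves `U`. -/
def Closed (X : Finset ℕ) (j : ℕ) (U : Set ℕ) : Prop :=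
  ∀ i < j, I.Act X i → (I.top i ∈ U ↔ I.bot i ∈ U)

/-- The active edges form a linear forest. -/
def LinForest (X : Finset ℕ) : Prop :=
  (∀ u, I.adeg X I.m u ≤ 2) ∧
    ∀ U : Set ℕ, U.Nonempty → I.Closed X I.m U → ∃ u ∈ U, I.adeg X I.m u ≤ 1

variable {I} {X : Finset ℕ}

theorem exists_inc_ne {u i : ℕ} (h : 2 ≤ I.deg u) : ∃ j < I.m, I.Inc u j ∧ j ≠ i := by
  obtain ⟨j, hj, hne⟩ := Finset.exists_mem_ne (s := (Finset.range I.m).filter (I.Inc u)) h i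
  simp only [Finset.mem_filter, Finset.mem_range] at hj
  exact ⟨j, hj.1, hj.2, hne⟩

theorem exists_act_inc_ne {u j : ℕ} (i : ℕ) (h : 2 ≤ I.adeg X j u) :
    ∃ i' < j, I.Act X i' ∧ I.Inc u i' ∧ i' ≠ i := by
  obtain ⟨i', hi', hne⟩ := Finset.exists_mem_ne
    (s := (Finset.range j).filter fun i => I.Act X i ∧ I.Inc u i) h i
  simp only [Finset.mem_filter, Finset.mem_range] at hi'
  exact ⟨i', hi'.1, hi'.2.1, hi'.2.2, hne⟩

theorem exists_sorted_of_two_lt_card {ι : Type*} {s : Finset ι} (f : ι → ℤ)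
    (hf : Set.InjOn f s) (h : 2 < s.card) : ∃ p ∈ s, ∃ q ∈ s, ∃ r ∈ s, f p < f q ∧ f q < f r := by
  obtain ⟨p, hp, q, hq, r, hr, hpq, hpr, hqr⟩ := Finset.two_lt_card.1 h
  have h1 := fun e => hpq (hf hp hq e)
  have h2 := fun e => hpr (hf hp hr e)
  have h3 := fun e => hqr (hf hq hr e)
  rcases lt_or_gt_of_ne h1 with h1 | h1 <;> rcases lt_or_gt_of_ne h2 with h2 | h2 <;>
    rcases lt_or_gt_of_ne h3 with h3 | h3
  · exact ⟨p, hp, q, hq, r, hr, h1, h3⟩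
  · exact ⟨p, hp, r, hr, q, hq, h2, h3⟩
  · omega
  · exact ⟨r, hr, p, hp, q, hq, h2, h1⟩
  · exact ⟨q, hq, p, hp, r, hr, h1, h2⟩
  · omega
  · exact ⟨q, hq, r, hr, p, hp, h3, h2⟩
  · exact ⟨r, hr, q, hq, p, hp, h3, h1⟩

/-- Monotone positions of the ends of the edges force the active edges to form a linear forest. -/
theorem linForest_of_monotone (τ β : ℕ → ℤ)
    (hτ : ∀ i < I.m, ∀ j < I.m, τ i = τ j ↔ I.top i = I.top j)
    (hβ : ∀ i < I.m, ∀ j < I.m, β i = β j → I.bot i = I.bot j)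
    (hβ' : ∀ i < I.m, ∀ j < I.m, I.bot i ∉ X → I.bot i = I.bot j → β i = β j)
    (hmono : ∀ i < I.m, ∀ j < I.m, τ i < τ j → β i ≤ β j) : I.LinForest X := by
  constructor
  · intro u
    by_contra! hc
    set s := (Finset.range I.m).filter fun i => I.Act X i ∧ I.Inc u i with hs
    have hmem : ∀ i ∈ s, i < I.m ∧ I.Act X i ∧ I.Inc u i := by simp [hs]
    by_cases hu : ∃ i < I.m, I.top i = u
    · obtain ⟨i₀, hi₀, rfl⟩ := hu
      have htop : ∀ i ∈ s, I.top i = I.top i₀ := fun i hi =>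
        (hmem i hi).2.2.resolve_right fun h => I.disj _ _ hi₀ (hmem i hi).1 h.symm
      have hinj : Set.InjOn β s := fun i hi j hj hij =>
        I.inj i j (hmem i hi).1 (hmem j hj).1 ((htop i hi).trans (htop j hj).symm)
          (hβ i (hmem i hi).1 j (hmem j hj).1 hij)
      -- The bottom end of the middle edge `q` has a further edge `j`. If its top end lies to the
      -- left, `j` crosses `p`; if to the right, it crosses `r`.
      obtain ⟨p, hp, q, hq, r, hr, hpq, hqr⟩ := exists_sorted_of_two_lt_card β hinj hc
      obtain ⟨hqm, hqa, -⟩ := hmem q hq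
      obtain ⟨j, hj, hjq, hne⟩ := exists_inc_ne (i := q) hqa.2.1
      have hbot : I.bot q = I.bot j := (hjq.resolve_left (I.disj j q hj hqm)).symm
      have hβj := hβ' q hqm j hj hqa.2.2 hbot
      have hτj : τ j ≠ τ q := fun h => hne (I.inj j q hj hqm ((hτ j hj q hqm).1 h) hbot.symm)
      have e1 := (hτ p (hmem p hp).1 q hqm).2 ((htop p hp).trans (htop q hq).symm)
      have e2 := (hτ r (hmem r hr).1 q hqm).2 ((htop r hr).trans (htop q hq).symm)
      rcases lt_or_gt_of_ne hτj with h | h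
      · have := hmono j hj p (hmem p hp).1 (by omega)
        omega
      · have := hmono r (hmem r hr).1 j hj (by omega)
        omega
    · have hbot : ∀ i ∈ s, I.bot i = u := fun i hi =>
        (hmem i hi).2.2.resolve_left fun h => hu ⟨i, (hmem i hi).1, h⟩
      have hinj : Set.InjOn τ s := fun i hi j hj hij =>
        I.inj i j (hmem i hi).1 (hmem j hj).1
          ((hτ i (hmem i hi).1 j (hmem j hj).1).1 hij) ((hbot i hi).trans (hbot j hj).symm)
      -- The top end of the middle edge `q` has a further edge `j`. Squeezed between `p` and `r`, it
      -- must end at the common bottom vertex, hence coincide with `q`.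
      obtain ⟨p, hp, q, hq, r, hr, hpq, hqr⟩ := exists_sorted_of_two_lt_card τ hinj hc
      obtain ⟨hqm, hqa, -⟩ := hmem q hq
      obtain ⟨j, hj, hjq, hne⟩ := exists_inc_ne (i := q) hqa.1
      have htop : I.top j = I.top q := hjq.resolve_right fun h => I.disj q j hqm hj h.symm
      have hτj := (hτ j hj q hqm).2 htop
      have e1 := hβ' q hqm p (hmem p hp).1 hqa.2.2 ((hbot q hq).trans (hbot p hp).symm)
      have e2 := hβ' q hqm r (hmem r hr).1 hqa.2.2 ((hbot q hq).trans (hbot r hr).symm)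
      have h1 := hmono p (hmem p hp).1 j hj (by omega)
      have h2 := hmono j hj r (hmem r hr).1 (by omega)
      exact hne (I.inj j q hj hqm htop (hβ j hj q hqm (by omega)))
  · intro U ⟨u, hu⟩ hU
    by_contra! hc
    classical
    set s := (Finset.range I.m).filter fun i => I.Act X i ∧ I.top i ∈ U with hs
    have hmem : ∀ i, i ∈ s ↔ i < I.m ∧ I.Act X i ∧ I.top i ∈ U := by simp [hs]
    have hne : s.Nonempty := by
      obtain ⟨i, hi, ha, hinc, -⟩ := exists_act_inc_ne I.m (hc u hu)
      refine ⟨i, (hmem i).2 ⟨hi, ha, ?_⟩⟩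
      rcases hinc with rfl | rfl
      · exact hu
      · exact (hU i hi ha).2 hu
    -- Take the leftmost top vertex in `U`. It has two active edges `p`, `q` with the bottom end of
    -- `p` further left. The second active edge at the bottom end of `p` goes to a top vertex
    -- further right, so it crosses `q`.
    obtain ⟨i, hi, hmin⟩ := Finset.exists_min_image s τ hne
    have key : ∀ p ∈ s, ∀ q ∈ s, τ p = τ i → τ q = τ i → β p < β q → False := by
      intro p hp q hq hpi hqi hlt
      obtain ⟨hpm, hpa, hpU⟩ := (hmem p).1 hp
      obtain ⟨j, hj, ha, hinc, hjp⟩ := exists_act_inc_ne p (hc _ ((hU p hpm hpa).1 hpU))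
      have hbot : I.bot j = I.bot p := hinc.resolve_left (I.disj j p hj hpm)
      have hjU : I.top j ∈ U := (hU j hj ha).2 (hbot ▸ (hU p hpm hpa).1 hpU)
      have h1 := hmin j ((hmem j).2 ⟨hj, ha, hjU⟩)
      have h2 : τ j ≠ τ p := fun h => hjp (I.inj j p hj hpm ((hτ j hj p hpm).1 h) hbot)
      have h3 := hmono q ((hmem q).1 hq).1 j hj (by omega)
      have h4 := hβ' j hj p hpm ha.2.2 hbot
      omega
    obtain ⟨him, hia, hiU⟩ := (hmem i).1 hi
    obtain ⟨j, hj, ha, hinc, hji⟩ := exists_act_inc_ne i (hc _ hiU)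
    have htop : I.top j = I.top i := hinc.resolve_right fun h => I.disj i j him hj h.symm
    have hjs : j ∈ s := (hmem j).2 ⟨hj, ha, htop ▸ hiU⟩
    have hτj := (hτ j hj i him).2 htop
    rcases lt_trichotomy (β i) (β j) with h | h | h
    · exact key i hi j hjs rfl hτj h
    · exact hji (I.inj j i hj him htop (hβ j hj i him h.symm))
    · exact key j hjs i hi hτj rfl h

/-- The vertices of a linear forest can be numbered so that adjacent vertices get consecutive
numbers. -/
theorem LinForest.exists_numbering_on (h : I.LinForest X) (U : Finset ℕ) :
    ∃ ρ : ℕ → ℤ, Set.InjOn ρ U ∧ ∀ i < I.m, I.Act X i → I.top i ∈ U → I.bot i ∈ U →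
      |ρ (I.top i) - ρ (I.bot i)| = 1 := by
  induction hn : U.card generalizing U with
  | zero =>
    obtain rfl := Finset.card_eq_zero.1 hn
    exact ⟨fun _ => 0, by simp, by simp⟩
  | succ n ih =>
    let inner : ℕ → Finset ℕ := fun u => (Finset.range I.m).filter fun i =>
      (I.Act X i ∧ I.Inc u i) ∧ I.top i ∈ U ∧ I.bot i ∈ U
    -- Some vertex has at most one active edge inside `U`. Otherwise the degree bound two would make
    -- all active edges at `U` inner ones, and `U` would be closed without a vertex of active degree
    -- at most one.
    have hex : ∃ u ∈ U, (inner u).card ≤ 1 := by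
      by_contra! hc
      have hall : ∀ u ∈ U, inner u = (Finset.range I.m).filter fun i => I.Act X i ∧ I.Inc u i := by
        intro u hu
        refine Finset.eq_of_subset_of_card_le (fun i hi => ?_) ((h.1 u).trans (hc u hu))
        simp only [inner, Finset.mem_filter] at hi ⊢
        exact ⟨hi.1, hi.2.1⟩
      have hcl : I.Closed X I.m U := by
        intro i hi ha
        constructor
        · intro hu
          have : i ∈ inner (I.top i) := by
            rw [hall _ hu]
            exact Finset.mem_filter.2 ⟨Finset.mem_range.2 hi, ha, .inl rfl⟩
          simp only [inner, Finset.mem_filter] at this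
          exact this.2.2.2
        · intro hu
          have : i ∈ inner (I.bot i) := by
            rw [hall _ hu]
            exact Finset.mem_filter.2 ⟨Finset.mem_range.2 hi, ha, .inr rfl⟩
          simp only [inner, Finset.mem_filter] at this
          exact this.2.2.1
      obtain ⟨u, hu, hle⟩ := h.2 U (Finset.card_pos.1 (by omega)) hcl
      have := hc u hu
      rw [hall u hu] at this
      unfold adeg at hle
      omega
    obtain ⟨u, hu, hle⟩ := hex
    obtain ⟨ρ, hρ, hadj⟩ := ih (U.erase u) (by rw [Finset.card_erase_of_mem hu, hn]; rfl)
    have hmem : ∀ {v}, v ∈ U → v ≠ u → v ∈ U.erase u := fun hv hne => Finset.mem_erase.2 ⟨hne, hv⟩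
    by_cases h0 : ∃ i, i ∈ inner u
    · obtain ⟨i₀, hi₀⟩ := h0
      have huniq : ∀ i ∈ inner u, i = i₀ := fun i hi => Finset.card_le_one.1 hle i hi i₀ hi₀
      obtain ⟨w, hw, hwu, hi₀w⟩ : ∃ w ∈ U, w ≠ u ∧
          (I.top i₀ = u ∧ I.bot i₀ = w ∨ I.bot i₀ = u ∧ I.top i₀ = w) := by
        simp only [inner, Finset.mem_filter, Finset.mem_range] at hi₀
        obtain ⟨him, ⟨ha, hinc⟩, ht, hb⟩ := hi₀
        have hd := I.disj i₀ i₀ him him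
        rcases hinc with hinc | hinc
        · exact ⟨_, hb, fun h => hd (hinc.trans h.symm), .inl ⟨hinc, rfl⟩⟩
        · exact ⟨_, ht, fun h => hd (h.trans hinc.symm), .inr ⟨hinc, rfl⟩⟩
      have hi₀' : i₀ < I.m ∧ I.Act X i₀ := by
        simp only [inner, Finset.mem_filter, Finset.mem_range] at hi₀
        exact ⟨hi₀.1, hi₀.2.1.1⟩
      -- one of the two sides of `w` is free
      have hside : ∃ σ : ℤ, (σ = 1 ∨ σ = -1) ∧ ∀ i < I.m, I.Act X i → I.Inc w i →
          I.top i ∈ U.erase u → I.bot i ∈ U.erase u →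
          σ * ρ (I.top i) + σ * ρ (I.bot i) < 2 * (σ * ρ w) := by
        by_cases hex : ∃ i < I.m, I.Act X i ∧ I.Inc w i ∧ I.top i ∈ U.erase u ∧ I.bot i ∈ U.erase u
        · obtain ⟨i₁, hi₁, ha₁, hw₁, ht₁, hb₁⟩ := hex
          have hd := hadj i₁ hi₁ ha₁ ht₁ hb₁
          have hall : ∀ i < I.m, I.Act X i → I.Inc w i →
              I.top i ∈ U.erase u → I.bot i ∈ U.erase u → i = i₁ := by
            intro i hi ha hwi ht hb
            by_contra hne
            have hne₀ : ∀ j, I.top j ∈ U.erase u → I.bot j ∈ U.erase u → j ≠ i₀ := by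
              rintro j ht hb rfl
              rcases hi₀w with ⟨h1, -⟩ | ⟨h1, -⟩
              · exact (Finset.mem_erase.1 ht).1 h1
              · exact (Finset.mem_erase.1 hb).1 h1
            have : ({i₀, i₁, i} : Finset ℕ).card ≤ I.adeg X I.m w := by
              refine Finset.card_le_card fun j hj => ?_
              simp only [Finset.mem_insert, Finset.mem_singleton] at hj
              simp only [Finset.mem_filter, Finset.mem_range]
              rcases hj with rfl | rfl | rfl
              · exact ⟨hi₀'.1, hi₀'.2, by rcases hi₀w with h | h <;> simp [Inc, h]⟩
              · exact ⟨hi₁, ha₁, hw₁⟩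
              · exact ⟨hi, ha, hwi⟩
            rw [Finset.card_eq_three.2 ⟨i₀, i₁, i, (hne₀ _ ht₁ hb₁).symm, (hne₀ _ ht hb).symm,
              Ne.symm hne, rfl⟩] at this
            have := h.1 w
            omega
          by_cases hs : ρ (I.top i₁) + ρ (I.bot i₁) < 2 * ρ w
          · refine ⟨1, .inl rfl, fun i hi ha hwi ht hb => ?_⟩
            rw [hall i hi ha hwi ht hb]
            linarith
          · refine ⟨-1, .inr rfl, fun i hi ha hwi ht hb => ?_⟩
            rw [hall i hi ha hwi ht hb]
            rcases hw₁ with hw₁ | hw₁ <;> rw [← hw₁] at hs ⊢ <;>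
              rcases abs_eq (by norm_num : (0 : ℤ) ≤ 1) |>.1 hd with hd | hd <;> omega
        · exact ⟨1, .inl rfl, fun i hi ha hwi ht hb => absurd ⟨i, hi, ha, hwi, ht, hb⟩ hex⟩
      obtain ⟨σ, hσ, hfree⟩ := hside
      -- Orient the line by `σ` so that the free side of `w` is above it, shift everything above `w`
      -- up by one, and place `u` in the gap. No edge within `U.erase u` joins numbers on both sides
      -- of the gap.
      refine ⟨fun v => if v = u then σ * ρ w + 1 else
        if σ * ρ v ≤ σ * ρ w then σ * ρ v else σ * ρ v + 1, ?_, ?_⟩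
      · intro v hv v' hv' hvv'
        by_cases h1 : v = u <;> by_cases h2 : v' = u
        · rw [h1, h2]
        · simp only [h1, h2, if_true, if_false] at hvv'
          split_ifs at hvv' <;> omega
        · simp only [h1, h2, if_true, if_false] at hvv'
          split_ifs at hvv' <;> omega
        · simp only [h1, h2, if_false] at hvv'
          refine hρ (hmem hv h1) (hmem hv' h2) ?_
          rcases hσ with rfl | rfl <;> split_ifs at hvv' <;> omega
      · intro i hi ha ht hb
        by_cases h1 : I.top i = u ∨ I.bot i = u
        · have hii : i = i₀ := huniq i (Finset.mem_filter.2 ⟨Finset.mem_range.2 hi, ⟨ha, h1⟩, ht, hb⟩)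
          subst hii
          rcases hi₀w with ⟨h2, h3⟩ | ⟨h2, h3⟩ <;> simp [h2, h3, hwu]
        · rw [not_or] at h1
          simp only [h1.1, h1.2, if_false]
          have hd := hadj i hi ha (hmem ht h1.1) (hmem hb h1.2)
          have hf := fun hw => hfree i hi ha hw (hmem ht h1.1) (hmem hb h1.2)
          have hwU := hmem hw hwu
          have e1 : ρ (I.top i) = ρ w → I.top i = w := fun h => hρ (hmem ht h1.1) hwU h
          have e2 : ρ (I.bot i) = ρ w → I.bot i = w := fun h => hρ (hmem hb h1.2) hwU h
          unfold Inc at hf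
          rcases abs_eq (by norm_num : (0 : ℤ) ≤ 1) |>.1 hd with hd | hd <;>
            rcases hσ with rfl | rfl <;> rw [abs_eq (by norm_num)] <;>
            split_ifs <;> omega
    -- Without an inner edge at `u`, any unused number will do.
    · obtain ⟨M, hM⟩ : ∃ M : ℤ, ∀ v ∈ U, ρ v < M := by
        obtain ⟨M, hM⟩ := (U.image ρ).bddAbove
        exact ⟨M + 1, fun v hv =>
          Int.lt_add_one_of_le (hM (Finset.mem_coe.2 (Finset.mem_image_of_mem ρ hv)))⟩
      refine ⟨fun v => if v = u then M else ρ v, ?_, ?_⟩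
      · intro v hv v' hv' hvv'
        have := hM v hv
        have := hM v' hv'
        by_cases h1 : v = u <;> by_cases h2 : v' = u <;> simp [h1, h2] at hvv' ⊢ <;> try omega
        exact hρ (hmem hv h1) (hmem hv' h2) hvv'
      · intro i hi ha ht hb
        have h1 : I.top i ≠ u := fun h1 =>
        h0 ⟨i, Finset.mem_filter.2 ⟨Finset.mem_range.2 hi, ⟨ha, .inl h1⟩, ht, hb⟩⟩
        have h2 : I.bot i ≠ u := fun h1 =>
        h0 ⟨i, Finset.mem_filter.2 ⟨Finset.mem_range.2 hi, ⟨ha, .inr h1⟩, ht, hb⟩⟩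
        simp only [h1, h2, if_false]
        exact hadj i hi ha (hmem ht h1) (hmem hb h2)

/-- The position of the top end of the `i`-th edge obtained from a numbering of the vertices of a
linear forest: vertices of degree one are placed at their neighbours. -/
def topKey (I : EdgeList) (X : Finset ℕ) (ρ : ℕ → ℤ) (i : ℕ) : ℤ :=
  if I.deg (I.top i) < 2 ∧ 2 ≤ I.deg (I.bot i) ∧ I.bot i ∉ X then ρ (I.bot i) else ρ (I.top i)

/-- The position of the bottom end of the `i`-th edge, see `topKey`. -/
def botKey (I : EdgeList) (X : Finset ℕ) (ρ : ℕ → ℤ) (i : ℕ) : ℤ :=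
  if 2 ≤ I.deg (I.bot i) ∧ I.bot i ∉ X then ρ (I.bot i) else ρ (I.top i)

/-- Non-leaves sit at their numbers along the paths and leaves at their neighbours. The keys may
coincide; a weak inequality at the top gives a strict one at the bottom, except at a shared unsplit
bottom vertex, so ties can later be broken arbitrarily. -/
theorem LinForest.exists_keys (h : I.LinForest X) : ∃ ρ : ℕ → ℤ,
    ∀ i < I.m, ∀ j < I.m, I.top i ≠ I.top j → I.topKey X ρ i ≤ I.topKey X ρ j →
      I.botKey X ρ i < I.botKey X ρ j ∨ (I.bot i = I.bot j ∧ I.bot i ∉ X) := by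
  obtain ⟨ρ, hρ, hadj⟩ := h.exists_numbering_on
    ((Finset.range I.m).image I.top ∪ (Finset.range I.m).image I.bot)
  have ht : ∀ i < I.m, I.top i ∈ (Finset.range I.m).image I.top ∪ (Finset.range I.m).image I.bot :=
    fun i hi => Finset.mem_union_left _ (Finset.mem_image_of_mem _ (Finset.mem_range.2 hi))
  have hb : ∀ i < I.m, I.bot i ∈ (Finset.range I.m).image I.top ∪ (Finset.range I.m).image I.bot :=
    fun i hi => Finset.mem_union_right _ (Finset.mem_image_of_mem _ (Finset.mem_range.2 hi))
  refine ⟨ρ, fun i hi j hj hne hle => ?_⟩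
  have h1 : ρ (I.top i) ≠ ρ (I.top j) := fun e => hne (hρ (ht i hi) (ht j hj) e)
  have h2 : ρ (I.top i) ≠ ρ (I.bot j) := fun e => I.disj i j hi hj (hρ (ht i hi) (hb j hj) e)
  have h3 : ρ (I.top j) ≠ ρ (I.bot i) := fun e => I.disj j i hj hi (hρ (ht j hj) (hb i hi) e)
  have h4 : ρ (I.bot i) = ρ (I.bot j) → I.bot i = I.bot j := fun e => hρ (hb i hi) (hb j hj) e
  have h5 : I.Act X i → (ρ (I.top i) - ρ (I.bot i) = 1 ∨ ρ (I.top i) - ρ (I.bot i) = -1) :=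
    fun ha => (abs_eq (by norm_num)).1 (hadj i hi ha (ht i hi) (hb i hi))
  have h6 : I.Act X j → (ρ (I.top j) - ρ (I.bot j) = 1 ∨ ρ (I.top j) - ρ (I.bot j) = -1) :=
    fun ha => (abs_eq (by norm_num)).1 (hadj j hj ha (ht j hj) (hb j hj))
  unfold Act at h5 h6
  unfold topKey at hle
  unfold botKey
  -- Numbers of distinct vertices differ, and they differ by exactly one along active edges; what
  -- remains is linear arithmetic in each case of leaf and non-leaf ends.
  by_cases b1 : I.bot i ∈ X <;> by_cases b2 : I.bot j ∈ X <;>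
    simp only [b1, b2, not_true_eq_false, not_false_eq_true, and_true, and_false, if_false] at * <;>
    (try split_ifs at hle ⊢) <;> omega

end EdgeList

end BipartiteSplit

namespace BipartiteSplit

namespace EdgeList

/-! ### Reduction of CRSV to linear forests of active edges -/

variable {a b : ℕ}

/-- The edge list `l`, with the top vertices numbered `0, …, a - 1` and the bottom vertices
numbered from `a`. -/
def ofList (l : List (Fin a × Fin b)) (hl : l.Nodup) : EdgeList where
  m := l.length
  top i := (l.map fun e => (e.1 : ℕ)).getD i 0
  bot i := a + (l.map fun e => (e.2 : ℕ)).getD i 0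
  disj i j hi hj := by
    have h1 := (l[i]).1.isLt
    simp [hi, hj]
    omega
  inj i j hi hj h1 h2 := by
    simp only [List.getD_eq_getElem?_getD, List.getElem?_map, hi, hj, getElem?_pos, Option.map_some,
      Option.getD_some, add_right_inj, Fin.val_inj] at h1 h2
    exact (hl.getElem_inj_iff).1 (Prod.ext h1 h2)

theorem ofList_edge {l : List (Fin a × Fin b)} (hl : l.Nodup) {i : ℕ} (hi : i < l.length) :
    (ofList l hl).top i = l[i].1 ∧ (ofList l hl).bot i = a + l[i].2 := by
  simp [ofList, hi]

/-- Split `X` fully and place each vertex by the key of any edge at it. The choice of edge is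
immaterial: keys of non-leaves depend on the vertex alone, and a leaf has only one edge. -/
theorem exists_drawing_of_linForest {l : List (Fin a × Fin b)} (hl : l.Nodup) {X : Finset ℕ}
    (h : (ofList l hl).LinForest X) :
    ∃ (B' : Type) (G' : Set (Fin a × B')) (o : B' → Fin b),
      SplitsInto {e | e ∈ l} {v | a + (v : ℕ) ∈ X} G' o ∧ HasPlanarDrawing G' := by
  classical
  obtain ⟨B', G', o, hs, hfull⟩ := SplitsInto.exists_full {e | e ∈ l} {v : Fin b | a + (v : ℕ) ∈ X}
  have := hs.finite
  refine ⟨B', G', o, hs, hasPlanarDrawing_iff.2 ?_⟩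
  set I := ofList l hl with hI
  obtain ⟨ρ, hρ⟩ := h.exists_keys
  have hidx : ∀ e ∈ G', ∃ i < I.m, I.top i = e.1 ∧ I.bot i = a + o e.2 := by
    rintro ⟨t, c⟩ he
    obtain ⟨i, hi, hie⟩ := List.mem_iff_getElem.1 (hs.mem t c he)
    obtain ⟨h1, h2⟩ := ofList_edge hl hi
    exact ⟨i, hi, by rw [h1, hie], by rw [h2, hie]⟩
  choose! ix him hit hib using hidx
  let x₀ : Fin a → ℤ := fun t => if h : ∃ c, (t, c) ∈ G' then I.topKey X ρ (ix (t, h.choose)) else 0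
  let y₀ : B' → ℤ := fun c => if h : ∃ t, (t, c) ∈ G' then I.botKey X ρ (ix (h.choose, c)) else 0
  have hx₀ : ∀ e ∈ G', x₀ e.1 = I.topKey X ρ (ix e) := by
    intro e he
    have hex : ∃ c, (e.1, c) ∈ G' := ⟨e.2, he⟩
    simp only [x₀, dif_pos hex]
    have hf := hex.choose_spec
    have htop : I.top (ix (e.1, hex.choose)) = I.top (ix e) := (hit _ hf).trans (hit e he).symm
    by_cases hd : I.deg (I.top (ix e)) < 2
    · rw [I.inj _ _ (him _ hf) (him e he) htop]
      by_contra hne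
      have h2 : 1 < I.deg (I.top (ix e)) := Finset.one_lt_card.2
        ⟨_, Finset.mem_filter.2 ⟨Finset.mem_range.2 (him e he), .inl rfl⟩, _,
          Finset.mem_filter.2 ⟨Finset.mem_range.2 (him _ hf), .inl htop⟩,
          fun h => hne (by rw [← h])⟩
      omega
    · simp only [topKey, htop, hd, false_and, if_false]
  have hy₀ : ∀ e ∈ G', y₀ e.2 = I.botKey X ρ (ix e) := by
    intro e he
    have hex : ∃ t, (t, e.2) ∈ G' := ⟨e.1, he⟩
    simp only [y₀, dif_pos hex]
    have hf := hex.choose_spec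
    have hbot : I.bot (ix (hex.choose, e.2)) = I.bot (ix e) := (hib _ hf).trans (hib e he).symm
    by_cases hX : o e.2 ∈ {v : Fin b | a + (v : ℕ) ∈ X}
    · have := hfull e.1 e.2 hex.choose hX he hf
      rw [this]
    by_cases hd : I.deg (I.bot (ix e)) < 2
    · rw [I.inj _ _ (him _ hf) (him e he) ?_ hbot]
      by_contra hne
      have h2 : 1 < I.deg (I.bot (ix e)) := Finset.one_lt_card.2
        ⟨_, Finset.mem_filter.2 ⟨Finset.mem_range.2 (him e he), .inr rfl⟩, _,
          Finset.mem_filter.2 ⟨Finset.mem_range.2 (him _ hf), .inr hbot⟩,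
          fun h => hne (by rw [← h])⟩
      omega
    · have hX' : I.bot (ix e) ∉ X := by rw [hib e he]; exact hX
      simp only [botKey, hbot, hX', not_lt.1 hd, not_false_eq_true, and_self, if_true]
  obtain ⟨n, ⟨ε⟩⟩ := Finite.exists_equiv_fin B'
  -- Ties are broken by placing each vertex at its key times `a + n + 1` plus its index. The factor
  -- exceeds every index, so positions are distinct and their order determines the weak order of
  -- keys.
  have hN : (0 : ℤ) < a + n + 1 := by positivity
  have hdiv : ∀ u v p q : ℤ, 0 ≤ p → p < a + n + 1 → 0 ≤ q → q < a + n + 1 →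
      (a + n + 1) * u + p ≤ (a + n + 1) * v + q → u ≤ v := by
    intro u v p q h1 h2 h3 h4 h5
    by_contra! hc
    nlinarith [mul_le_mul_of_nonneg_left (Int.add_one_le_iff.2 hc) hN.le]
  have hdiv' : ∀ u v p q : ℤ, 0 ≤ p → p < a + n + 1 → 0 ≤ q → q < a + n + 1 →
      (a + n + 1) * u + p = (a + n + 1) * v + q → p = q := by
    intro u v p q h1 h2 h3 h4 h5
    have := le_antisymm (hdiv u v p q h1 h2 h3 h4 h5.le) (hdiv v u q p h3 h4 h1 h2 h5.ge)
    rw [this] at h5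
    linarith
  have hta : ∀ t : Fin a, (0 : ℤ) ≤ (t : ℕ) ∧ ((t : ℕ) : ℤ) < a + n + 1 := fun t => by
    have := t.isLt; omega
  have hcn : ∀ c : B', (0 : ℤ) ≤ (ε c : ℕ) ∧ ((ε c : ℕ) : ℤ) < a + n + 1 := fun c => by
    have := (ε c).isLt; omega
  refine ⟨fun t => (a + n + 1) * x₀ t + (t : ℕ), fun c => (a + n + 1) * y₀ c + (ε c : ℕ),
    fun t t' htt => ?_, fun c c' hcc => ?_, fun e he f hf hlt => ?_⟩
  · have := hdiv' _ _ _ _ (hta t).1 (hta t).2 (hta t').1 (hta t').2 htt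
    exact Fin.ext (by exact_mod_cast this)
  · have := hdiv' _ _ _ _ (hcn c).1 (hcn c).2 (hcn c').1 (hcn c').2 hcc
    exact ε.injective (Fin.ext (by exact_mod_cast this))
  · have hle := hdiv _ _ _ _ (hta _).1 (hta _).2 (hta _).1 (hta _).2 hlt.le
    rw [hx₀ e he, hx₀ f hf] at hle
    have hne : I.top (ix e) ≠ I.top (ix f) := by
      rw [hit e he, hit f hf]
      intro h
      rw [Fin.ext h] at hlt
      exact lt_irrefl _ hlt
    rcases hρ _ (him e he) _ (him f hf) hne hle with h | ⟨h, hX⟩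
    · rw [← hy₀ e he, ← hy₀ f hf] at h
      by_contra! hc
      exact absurd (hdiv _ _ _ _ (hcn _).1 (hcn _).2 (hcn _).1 (hcn _).2 hc.le) (not_le.2 h)
    · rw [hib e he] at hX
      rw [hib e he, hib f hf] at h
      have hX' : o e.2 ∉ {v : Fin b | a + (v : ℕ) ∈ X} := hX
      have : e.2 = f.2 := hs.copy_unique _ _ (Fin.ext (by omega)) hX'
      simp only [this, le_refl]

/-- Every input edge survives at some copy of its bottom end, and the positions of these surviving
edges are monotone. The splitting need not be complete: only the unsplit vertices need a single
position. -/
theorem linForest_of_drawing {l : List (Fin a × Fin b)} (hl : l.Nodup) {X : Finset (Fin b)}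
    {B' : Type} {G' : Set (Fin a × B')} {o : B' → Fin b}
    (hs : SplitsInto {e | e ∈ l} (X : Set (Fin b)) G' o) (hd : HasPlanarDrawing G') :
    (ofList l hl).LinForest (X.image fun v : Fin b => a + (v : ℕ)) := by
  obtain ⟨x, y, hx, hy, hmono⟩ := hasPlanarDrawing_iff.1 hd
  set I := ofList l hl with hI
  have hE : ∀ i < I.m, ∃ e ∈ G', I.top i = e.1 ∧ I.bot i = a + o e.2 := by
    intro i hi
    obtain ⟨c, hc, hm⟩ := hs.exists_copy (l[i]'hi).1 (l[i]'hi).2 (List.getElem_mem hi)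
    obtain ⟨h1, h2⟩ := ofList_edge hl hi
    exact ⟨_, hm, h1, by rw [h2]; simp [hc]⟩
  choose E hE ht hb using hE
  refine linForest_of_monotone (fun i => if h : i < I.m then x (E i h).1 else 0)
    (fun i => if h : i < I.m then y (E i h).2 else 0) ?_ ?_ ?_ ?_ <;> intro i hi j hj <;>
    simp only [dif_pos hi, dif_pos hj]
  · rw [hx.eq_iff, ht i hi, ht j hj, Fin.val_inj]
  · intro h
    rw [hb i hi, hb j hj, hy h]
  · intro hX h
    rw [hb i hi] at hX h
    rw [hb j hj] at h
    rw [hs.copy_unique (E i hi).2 (E j hj).2 (Fin.ext (by omega))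
      fun hm => hX (Finset.mem_image_of_mem _ hm)]
  · exact hmono _ (hE i hi) _ (hE j hj)

/-- CRSV asks for at most `k` vertices without which the active edges form a linear forest. -/
theorem crsv_iff {l : List (Fin a × Fin b)} (hl : l.Nodup) (k : ℕ) :
    CRSV {e | e ∈ l} k ↔ ∃ X : Finset ℕ, X.card ≤ k ∧ (ofList l hl).LinForest X := by
  constructor
  · rintro ⟨X, hX, B', G', o, hs, hd⟩
    exact ⟨_, Finset.card_image_le.trans hX, linForest_of_drawing hl hs hd⟩
  · rintro ⟨X, hX, h⟩
    obtain ⟨B', G', o, hs, hd⟩ := exists_drawing_of_linForest hl h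
    refine ⟨Finset.univ.filter fun v : Fin b => a + (v : ℕ) ∈ X, ?_, B', G', o, by simpa using hs, hd⟩
    refine (Finset.card_le_card_of_injOn (fun v : Fin b => a + (v : ℕ)) (by intro v; simp) ?_).trans hX
    intro v _ w _ h
    exact Fin.ext (by simpa using h)

end EdgeList

end BipartiteSplit

namespace BipartiteSplit

namespace EdgeList

variable {I : EdgeList} {X : Finset ℕ}

/-! ### Conflicts -/

/-- `r` further vertices suffice to complete `X` to a solution. -/
def Solvable (I : EdgeList) (X : Finset ℕ) (r : ℕ) : Prop :=
  ∃ Y : Finset ℕ, Y.card ≤ r ∧ I.LinForest (X ∪ Y)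

/-- If `X` can be completed, then it can be completed starting with one of `c₁`, `c₂`, `c₃`. -/
def Conflict (I : EdgeList) (X : Finset ℕ) (c₁ c₂ c₃ : ℕ) : Prop :=
  ∀ r, I.Solvable X r → ∃ r', r = r' + 1 ∧
    (I.Solvable (insert c₁ X) r' ∨ I.Solvable (insert c₂ X) r' ∨ I.Solvable (insert c₃ X) r')

theorem adeg_zero (u : ℕ) : I.adeg X 0 u = 0 := by simp [adeg]

theorem adeg_succ (j u : ℕ) :
    I.adeg X (j + 1) u = I.adeg X j u + if I.Act X j ∧ I.Inc u j then 1 else 0 := by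
  unfold adeg
  rw [Finset.range_add_one, Finset.filter_insert]
  split_ifs with h
  · rw [Finset.card_insert_of_notMem (by simp)]
  · rfl

theorem adeg_mono {j j' : ℕ} (h : j ≤ j') (u : ℕ) : I.adeg X j u ≤ I.adeg X j' u :=
  Finset.card_le_card (Finset.filter_subset_filter _ (Finset.range_mono h))

theorem adeg_le (j u : ℕ) : I.adeg X j u ≤ j := by
  simpa [adeg] using Finset.card_filter_le (Finset.range j) _

theorem Act.mono {Y : Finset ℕ} (h : X ⊆ Y) {i : ℕ} (ha : I.Act Y i) : I.Act X i :=
  ⟨ha.1, ha.2.1, fun hX => ha.2.2 (h hX)⟩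

theorem adeg_anti {Y : Finset ℕ} (h : X ⊆ Y) (j u : ℕ) : I.adeg Y j u ≤ I.adeg X j u :=
  Finset.card_le_card fun i hi => by
    simp only [Finset.mem_filter] at hi ⊢
    exact ⟨hi.1, hi.2.1.mono h, hi.2.2⟩

theorem Solvable.insert_of_mem {Y : Finset ℕ} {c r : ℕ} (hc : c ∈ Y) (hr : Y.card ≤ r)
    (h : I.LinForest (insert c X ∪ Y.erase c)) :
    ∃ r', r = r' + 1 ∧ I.Solvable (insert c X) r' := by
  have h1 := Finset.card_erase_of_mem hc
  have h2 := Finset.card_pos.2 ⟨c, hc⟩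
  exact ⟨r - 1, by omega, Y.erase c, by omega, h⟩

theorem insert_union_erase {Y : Finset ℕ} {c : ℕ} (hc : c ∈ Y) :
    insert c X ∪ Y.erase c = X ∪ Y := by
  rw [Finset.insert_union, ← Finset.union_insert, Finset.insert_erase hc]

/-- Three active edges at a top vertex. -/
theorem conflict_top {t i₁ i₂ i₃ : ℕ} (h₁ : i₁ < I.m) (h₂ : i₂ < I.m) (h₃ : i₃ < I.m)
    (a₁ : I.Act X i₁) (a₂ : I.Act X i₂) (a₃ : I.Act X i₃) (t₁ : I.top i₁ = t) (t₂ : I.top i₂ = t)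
    (t₃ : I.top i₃ = t) (h₁₂ : i₁ ≠ i₂) (h₁₃ : i₁ ≠ i₃) (h₂₃ : i₂ ≠ i₃) :
    I.Conflict X (I.bot i₁) (I.bot i₂) (I.bot i₃) := by
  rintro r ⟨Y, hr, hY⟩
  by_cases m₁ : I.bot i₁ ∈ Y
  · obtain ⟨r', hr', hs⟩ := Solvable.insert_of_mem m₁ hr (by rwa [insert_union_erase m₁])
    exact ⟨r', hr', .inl hs⟩
  by_cases m₂ : I.bot i₂ ∈ Y
  · obtain ⟨r', hr', hs⟩ := Solvable.insert_of_mem m₂ hr (by rwa [insert_union_erase m₂])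
    exact ⟨r', hr', .inr (.inl hs)⟩
  by_cases m₃ : I.bot i₃ ∈ Y
  · obtain ⟨r', hr', hs⟩ := Solvable.insert_of_mem m₃ hr (by rwa [insert_union_erase m₃])
    exact ⟨r', hr', .inr (.inr hs)⟩
  -- If the solution avoids all three bottom ends, the three edges stay active and `t` has active
  -- degree at least three.
  have : ({i₁, i₂, i₃} : Finset ℕ).card ≤ I.adeg (X ∪ Y) I.m t := by
    refine Finset.card_le_card fun j hj => ?_
    simp only [Finset.mem_insert, Finset.mem_singleton] at hj
    rw [Finset.mem_filter, Finset.mem_range]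
    have key : ∀ i, i < I.m → I.Act X i → I.top i = t → I.bot i ∉ Y →
        i < I.m ∧ I.Act (X ∪ Y) i ∧ I.Inc t i := fun i hi ha ht hm =>
      ⟨hi, ⟨ha.1, ha.2.1, by simp [ha.2.2, hm]⟩, .inl ht⟩
    rcases hj with rfl | rfl | rfl
    · exact key _ h₁ a₁ t₁ m₁
    · exact key _ h₂ a₂ t₂ m₂
    · exact key _ h₃ a₃ t₃ m₃
  rw [Finset.card_eq_three.2 ⟨i₁, i₂, i₃, h₁₂, h₁₃, h₂₃, rfl⟩] at this
  have := hY.1 t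
  omega

/-- Three active edges at a bottom vertex. -/
theorem conflict_bot {i : ℕ} (hi : i < I.m) (h : 3 ≤ I.adeg X I.m (I.bot i)) :
    I.Conflict X (I.bot i) (I.bot i) (I.bot i) := by
  rintro r ⟨Y, hr, hY⟩
  have hm : I.bot i ∈ Y := by
    by_contra hm
    have h2 : I.adeg X I.m (I.bot i) ≤ I.adeg (X ∪ Y) I.m (I.bot i) := by
      refine Finset.card_le_card fun j hj => ?_
      simp only [Finset.mem_filter, Finset.mem_range] at hj ⊢
      obtain ⟨hj, ha, hinc⟩ := hj
      have hb : I.bot j = I.bot i := hinc.resolve_left (I.disj j i hj hi)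
      refine ⟨hj, ⟨ha.1, ha.2.1, ?_⟩, hinc⟩
      rw [Finset.mem_union, not_or]
      exact ⟨ha.2.2, hb ▸ hm⟩
    have := hY.1 (I.bot i)
    omega
  obtain ⟨r', hr', hs⟩ := Solvable.insert_of_mem hm hr (by rwa [insert_union_erase hm])
  exact ⟨r', hr', .inl hs⟩

/-- A bottom vertex of a component that is a cycle. -/
theorem conflict_cycle {i : ℕ} {U : Set ℕ} (hi : i < I.m) (hdeg : ∀ u, I.adeg X I.m u ≤ 2)
    (hU : I.Closed X I.m U) (hU2 : ∀ u ∈ U, 2 ≤ I.adeg X I.m u) (hiU : I.bot i ∈ U)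
    (hmin : ∀ V : Set ℕ, I.Closed X I.m V → ∀ u ∈ U, u ∈ V → I.bot i ∈ V) :
    I.Conflict X (I.bot i) (I.bot i) (I.bot i) := by
  rintro r ⟨Y, hr, hY⟩
  -- A solution must meet `U`, since otherwise all edges of `U` stay active and no degree there
  -- drops.
  obtain ⟨c, hcY, hcU⟩ : ∃ c ∈ Y, c ∈ U := by
    by_contra! hc
    obtain ⟨u, hu, hle⟩ := hY.2 U ⟨_, hiU⟩ fun j hj ha => hU j hj (ha.mono Finset.subset_union_left)
    have h2 : I.adeg X I.m u ≤ I.adeg (X ∪ Y) I.m u := by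
      refine Finset.card_le_card fun j hj => ?_
      simp only [Finset.mem_filter, Finset.mem_range] at hj ⊢
      obtain ⟨hj, ha, hinc⟩ := hj
      have hb : I.bot j ∈ U := by
        rcases hinc with h | h
        · exact (hU j hj ha).1 (h ▸ hu)
        · exact h ▸ hu
      refine ⟨hj, ⟨ha.1, ha.2.1, ?_⟩, hinc⟩
      rw [Finset.mem_union, not_or]
      exact ⟨ha.2.2, fun h => hc _ h hb⟩
    have := hU2 u hu
    omega
  -- Exchange argument: `c` is replaced by the prescribed vertex of the same cycle.
  set X' := insert (I.bot i) X ∪ Y.erase c with hX'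
  have hXX' : X ⊆ X' := (Finset.subset_insert _ _).trans Finset.subset_union_left
  have hlin : I.LinForest X' := by
    refine ⟨fun u => (adeg_anti hXX' I.m u).trans (hdeg u), fun V hne hV => ?_⟩
    by_contra! hV2
    -- With degrees at most two before and at least two now, no active edge at `V` was lost; so `V`
    -- is closed already for `X`.
    have hact : ∀ u ∈ V, ∀ j < I.m, I.Act X j → I.Inc u j → I.Act X' j := by
      intro u hu j hj ha hinc
      have hsub : (Finset.range I.m).filter (fun i => I.Act X' i ∧ I.Inc u i) ⊆
          (Finset.range I.m).filter fun i => I.Act X i ∧ I.Inc u i := fun i hi => by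
        simp only [Finset.mem_filter] at hi ⊢
        exact ⟨hi.1, hi.2.1.mono hXX', hi.2.2⟩
      have heq := Finset.eq_of_subset_of_card_le hsub ((hdeg u).trans (hV2 u hu))
      have hm : j ∈ (Finset.range I.m).filter fun i => I.Act X i ∧ I.Inc u i :=
        Finset.mem_filter.2 ⟨Finset.mem_range.2 hj, ha, hinc⟩
      rw [← heq] at hm
      exact (Finset.mem_filter.1 hm).2.1
    have hVX : I.Closed X I.m V := by
      intro j hj ha
      constructor
      · intro h
        exact (hV j hj (hact _ h j hj ha (.inl rfl))).1 h
      · intro h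
        exact (hV j hj (hact _ h j hj ha (.inr rfl))).2 h
    have hiV : I.bot i ∉ V := by
      intro h
      obtain ⟨j, hj, ha, hinc, -⟩ := exists_act_inc_ne I.m (hV2 _ h)
      have hb : I.bot j = I.bot i := hinc.resolve_left (I.disj j i hj hi)
      exact ha.2.2 (by rw [hb, hX']; simp)
    -- By connectedness of the cycle, `V` would otherwise contain the chosen vertex, which has no
    -- active edges left. Hence giving up `c` does not affect `V`, and the old solution yields the
    -- contradiction.
    have hcV : c ∉ V := fun h => hiV (hmin V hVX c hcU h)
    obtain ⟨u, hu, hle⟩ := hY.2 V hne fun j hj ha => hVX j hj (ha.mono Finset.subset_union_left)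
    have h2 : I.adeg X' I.m u ≤ I.adeg (X ∪ Y) I.m u := by
      refine Finset.card_le_card fun j hj => ?_
      simp only [Finset.mem_filter, Finset.mem_range] at hj ⊢
      obtain ⟨hj, ha, hinc⟩ := hj
      have hb : I.bot j ∈ V := by
        rcases hinc with h | h
        · exact (hV j hj ha).1 (h ▸ hu)
        · exact h ▸ hu
      refine ⟨hj, ⟨ha.1, ha.2.1, ?_⟩, hinc⟩
      have h3 := ha.2.2
      have h4 : I.bot j ≠ c := fun h => hcV (h ▸ hb)
      simp only [hX', Finset.mem_union, Finset.mem_insert, Finset.mem_erase, not_or, not_and] at h3 ⊢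
      exact ⟨h3.1.2, h3.2 h4⟩
    have := hV2 u hu
    omega
  have h1 := Finset.card_erase_of_mem hcY
  have h2 := Finset.card_pos.2 ⟨c, hcY⟩
  exact ⟨r - 1, by omega, .inl ⟨Y.erase c, by omega, hlin⟩⟩

/-! ### One scan of the edge list -/

/-- The data kept during a scan: the current degrees, the first two neighbours of the top vertices,
the other ends of the current paths, and the conflict found (if `f` is not `0`). -/
structure Scan where
  cnt : ℕ → ℕ
  n₁ : ℕ → ℕ
  n₂ : ℕ → ℕ
  mate : ℕ → ℕ
  f : ℕ
  c₁ : ℕ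
  c₂ : ℕ
  c₃ : ℕ

namespace Scan

/-- The data before a scan. -/
def init : Scan := ⟨fun _ => 0, fun _ => 0, fun _ => 0, id, 0, 0, 0, 0⟩

/-- Record an edge from `t` to `q` at its top end. -/
def noteTop (t q : ℕ) (S : Scan) : Scan :=
  if S.cnt t < 2 then
    if S.cnt t < 1 then
      { S with n₁ := Function.update S.n₁ t q, cnt := Function.update S.cnt t (S.cnt t + 1) }
    else { S with n₂ := Function.update S.n₂ t q, cnt := Function.update S.cnt t (S.cnt t + 1) }
  else { S with f := 1, c₁ := S.n₁ t, c₂ := S.n₂ t, c₃ := q,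
                cnt := Function.update S.cnt t (S.cnt t + 1) }

/-- Record an edge at its bottom end `q`. -/
def noteBot (q : ℕ) (S : Scan) : Scan :=
  if S.cnt q < 2 then { S with cnt := Function.update S.cnt q (S.cnt q + 1) }
  else { S with f := 1, c₁ := q, c₂ := q, c₃ := q, cnt := Function.update S.cnt q (S.cnt q + 1) }

theorem cnt_noteTop (t q : ℕ) (S : Scan) :
    (S.noteTop t q).cnt = Function.update S.cnt t (S.cnt t + 1) := by
  unfold noteTop
  split_ifs <;> rfl

theorem cnt_noteBot (q : ℕ) (S : Scan) :
    (S.noteBot q).cnt = Function.update S.cnt q (S.cnt q + 1) := by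
  unfold noteBot
  split_ifs <;> rfl

/-- Join the paths ending in `t` and `q` by an edge, or report a cycle. -/
def link (t q : ℕ) (S : Scan) : Scan :=
  if S.f < 1 then
    if S.mate t = q then { S with f := 1, c₁ := q, c₂ := q, c₃ := q }
    else { S with mate := Function.update (Function.update S.mate (S.mate t) (S.mate q))
                            (S.mate q) (S.mate t) }
  else S

end Scan

/-- The degrees of the first `j` edges. -/
def degScan (I : EdgeList) (X : Finset ℕ) : ℕ → Scan
  | 0 => Scan.init
  | j + 1 => if I.Act X j then ((degScan I X j).noteTop (I.top j) (I.bot j)).noteBot (I.bot j)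
             else degScan I X j

/-- The paths and cycles formed by the first `j` edges. -/
def cycScan (I : EdgeList) (X : Finset ℕ) : ℕ → Scan
  | 0 => I.degScan X I.m
  | j + 1 => if I.Act X j then (cycScan I X j).link (I.top j) (I.bot j) else cycScan I X j

/-- The result of the scan. -/
def scan (I : EdgeList) (X : Finset ℕ) : Scan := I.cycScan X I.m

/-- The invariant of `degScan`. -/
structure DegInv (I : EdgeList) (X : Finset ℕ) (j : ℕ) (S : Scan) : Prop where
  cnt : ∀ u, S.cnt u = I.adeg X j u
  one : ∀ i₀ < I.m, I.adeg X j (I.top i₀) = 1 →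
    ∃ i < j, I.Act X i ∧ I.top i = I.top i₀ ∧ S.n₁ (I.top i₀) = I.bot i
  two : ∀ i₀ < I.m, 2 ≤ I.adeg X j (I.top i₀) →
    ∃ i < j, ∃ i' < j, i ≠ i' ∧ I.Act X i ∧ I.Act X i' ∧ I.top i = I.top i₀ ∧
      I.top i' = I.top i₀ ∧ S.n₁ (I.top i₀) = I.bot i ∧ S.n₂ (I.top i₀) = I.bot i'
  free : S.f = 0 → ∀ u, I.adeg X j u ≤ 2
  conflict : S.f ≠ 0 → I.Conflict X S.c₁ S.c₂ S.c₃
  mate : S.mate = id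

/-- A conflict seen among the first `j` edges is one for the whole list, because active degrees only
grow with `j`. At the third edge of a top vertex, the two stored neighbours and the current bottom
end are the three choices. -/
theorem degInv_degScan {j : ℕ} (hj : j ≤ I.m) : I.DegInv X j (I.degScan X j) := by
  induction j with
  | zero =>
    refine ⟨?_, ?_, ?_, ?_, ?_, rfl⟩ <;> simp [degScan, Scan.init, adeg_zero]
  | succ j ih =>
    have ih := ih (by omega)
    rw [degScan]
    split_ifs with ha
    swap
    · have hd : ∀ u, I.adeg X (j + 1) u = I.adeg X j u := fun u => by simp [adeg_succ, ha]
      obtain ⟨h1, h2, h3, h4, h5, h6⟩ := ih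
      refine ⟨by simpa [hd] using h1, fun i₀ hi₀ h => ?_, fun i₀ hi₀ h => ?_, by simpa [hd] using h4,
        h5, h6⟩
      · obtain ⟨i, hi, h⟩ := h2 i₀ hi₀ (by rwa [hd] at h)
        exact ⟨i, by omega, h⟩
      · obtain ⟨i, hi, i', hi', h⟩ := h3 i₀ hi₀ (by rwa [hd] at h)
        exact ⟨i, by omega, i', by omega, h⟩
    · set S := I.degScan X j with hS
      set t := I.top j with ht
      set q := I.bot j with hq
      have htq : t ≠ q := I.disj j j hj hj
      have hd : ∀ u, I.adeg X (j + 1) u = I.adeg X j u + if u = t ∨ u = q then 1 else 0 := by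
        intro u
        rw [adeg_succ]
        simp only [ha, true_and, Inc, ← ht, ← hq, eq_comm]
      have hcnt : ((S.noteTop t q).noteBot q).cnt = fun u => I.adeg X (j + 1) u := by
        funext u
        rw [hd, Scan.cnt_noteBot, Scan.cnt_noteTop]
        by_cases h1 : u = t
        · simp [h1, htq, ih.cnt]
        · by_cases h2 : u = q <;> simp [h1, h2, htq.symm, ih.cnt]
      have hn₁ : ((S.noteTop t q).noteBot q).n₁ =
          if S.cnt t < 1 then Function.update S.n₁ t q else S.n₁ := by
        simp only [Scan.noteTop, Scan.noteBot]
        split_ifs <;> first | rfl | omega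
      have hn₂ : ((S.noteTop t q).noteBot q).n₂ =
          if S.cnt t = 1 then Function.update S.n₂ t q else S.n₂ := by
        simp only [Scan.noteTop, Scan.noteBot]
        split_ifs <;> first | rfl | omega
      have hne : ∀ i₀ < I.m, I.top i₀ ≠ q := fun i₀ hi₀ => I.disj i₀ j hi₀ hj
      have htop : 2 ≤ S.cnt t → I.Conflict X (S.n₁ t) (S.n₂ t) q := by
        intro h
        obtain ⟨i, hi, i', hi', hii, a1, a2, t1, t2, e1, e2⟩ := ih.two j hj (by rw [← ih.cnt]; exact h)
        rw [e1, e2]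
        exact conflict_top (by omega) (by omega) hj a1 a2 ha t1 t2 rfl hii (by omega) (by omega)
      have hbot : 2 ≤ I.adeg X j q → I.Conflict X q q q := by
        intro h
        refine conflict_bot hj (le_trans ?_ (adeg_mono (j := j + 1) hj _))
        rw [← hq, hd]
        simp only [or_true, if_true]
        omega
      refine ⟨fun u => by rw [hcnt], fun i₀ hi₀ h => ?_, fun i₀ hi₀ h => ?_, fun h => ?_, fun h => ?_, ?_⟩
      · rw [hn₁]
        by_cases e : I.top i₀ = t
        · rw [hd, e] at h
          simp only [true_or, if_true] at h
          refine ⟨j, by omega, ha, e.symm, ?_⟩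
          rw [if_pos (by rw [ih.cnt]; omega), e, Function.update_self]
        · rw [hd] at h
          simp only [e, hne i₀ hi₀, or_self, if_false, add_zero] at h
          obtain ⟨i, hi, h1, h2, h3⟩ := ih.one i₀ hi₀ h
          refine ⟨i, by omega, h1, h2, ?_⟩
          split_ifs <;> simp [e, h3]
      · rw [hn₁, hn₂]
        by_cases e : I.top i₀ = t
        · rw [hd, e] at h
          simp only [true_or, if_true] at h
          by_cases h1 : I.adeg X j t = 1
          · obtain ⟨i, hi, a1, t1, e1⟩ := ih.one j hj h1
            refine ⟨i, by omega, j, by omega, by omega, a1, ha, t1.trans e.symm, e.symm, ?_, ?_⟩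
            · rw [if_neg (by rw [ih.cnt]; omega), e, e1]
            · rw [if_pos (by rw [ih.cnt]; omega), e, Function.update_self]
          · obtain ⟨i, hi, i', hi', hii, a1, a2, t1, t2, e1, e2⟩ := ih.two j hj (by rw [← ht]; omega)
            refine ⟨i, by omega, i', by omega, hii, a1, a2, t1.trans e.symm, t2.trans e.symm, ?_, ?_⟩
            · rw [if_neg (by rw [ih.cnt]; omega), e, e1]
            · rw [if_neg (by rw [ih.cnt]; omega), e, e2]
        · rw [hd] at h
          simp only [e, hne i₀ hi₀, or_self, if_false, add_zero] at h
          obtain ⟨i, hi, i', hi', hii, a1, a2, t1, t2, e1, e2⟩ := ih.two i₀ hi₀ h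
          refine ⟨i, by omega, i', by omega, hii, a1, a2, t1, t2, ?_, ?_⟩
          · split_ifs <;> simp [e, e1]
          · split_ifs <;> simp [e, e2]
      · have h1 : S.cnt t < 2 ∧ S.cnt q < 2 ∧ S.f = 0 := by
          simp only [Scan.noteTop, Scan.noteBot] at h
          by_cases h1 : S.cnt t < 2 <;> by_cases h2 : S.cnt q < 2 <;> by_cases h3 : S.cnt t < 1 <;>
            simp only [h1, h2, h3, if_true, if_false, Function.update_apply, htq.symm,
              one_ne_zero] at h
          all_goals exact ⟨h1, h2, h⟩
        intro u
        rw [hd]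
        have := ih.free h1.2.2 u
        have h2 := ih.cnt t
        have h3 := ih.cnt q
        split_ifs with hu
        · rcases hu with rfl | rfl <;> omega
        · exact this
      · have hq' := ih.cnt q
        simp only [Scan.noteTop, Scan.noteBot] at h ⊢
        by_cases h1 : S.cnt t < 2 <;> by_cases h2 : S.cnt q < 2 <;> by_cases h3 : S.cnt t < 1 <;>
          simp only [h1, h2, h3, if_true, if_false, Function.update_apply, htq.symm] at h ⊢
        all_goals first
          | exact ih.conflict h
          | exact htop (by omega)
          | exact hbot (by omega)
      · simp only [Scan.noteTop, Scan.noteBot]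
        split_ifs <;> exact ih.mate

/-- The invariant of `cycScan`: `comp` labels the components of the first `j` edges, and `mate` maps
each end of a path to the other one. -/
structure CycInv (I : EdgeList) (X : Finset ℕ) (j : ℕ) (mate comp : ℕ → ℕ) : Prop where
  edge : ∀ i < j, I.Act X i → comp (I.top i) = comp (I.bot i)
  conn : ∀ U : Set ℕ, I.Closed X j U → ∀ v ∈ U, ∀ w, comp v = comp w → w ∈ U
  ends : ∀ u v, I.adeg X j u ≤ 1 → I.adeg X j v ≤ 1 → (comp u = comp v ↔ v = u ∨ v = mate u)
  mate_le : ∀ u, I.adeg X j u ≤ 1 → I.adeg X j (mate u) ≤ 1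
  mate_mate : ∀ u, I.adeg X j u ≤ 1 → mate (mate u) = u
  mate_eq : ∀ u, I.adeg X j u ≤ 1 → (mate u = u ↔ I.adeg X j u = 0)
  exists_end : ∀ v, ∃ u, comp u = comp v ∧ I.adeg X j u ≤ 1

/-- Joining two different paths at the ends `t`, `q` leaves `mate t` and `mate q` as the ends of the
new path, so only these two entries change. Entries at inner vertices may be stale, as the invariant
speaks of ends only. -/
theorem CycInv.link {j : ℕ} {mate comp : ℕ → ℕ} (h : I.CycInv X j mate comp) (hj : j < I.m)
    (ha : I.Act X j) (hdeg : ∀ u, I.adeg X (j + 1) u ≤ 2) (hne : mate (I.top j) ≠ I.bot j) :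
    I.CycInv X (j + 1) (Function.update (Function.update mate (mate (I.top j)) (mate (I.bot j)))
      (mate (I.bot j)) (mate (I.top j)))
      (fun v => if comp v = comp (I.bot j) then comp (I.top j) else comp v) := by
  have htq : I.top j ≠ I.bot j := I.disj j j hj hj
  have hd : ∀ u, I.adeg X (j + 1) u = I.adeg X j u + if u = I.top j ∨ u = I.bot j then 1 else 0 := by
    intro u
    rw [adeg_succ]
    simp only [ha, true_and, Inc, eq_comm]
  have hcl : ∀ U, I.Closed X (j + 1) U → I.Closed X j U ∧ (I.top j ∈ U ↔ I.bot j ∈ U) := fun U hU =>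
    ⟨fun i hi => hU i (by omega), hU j (by omega) ha⟩
  obtain ⟨h1, h2, h3, h4, h5, h6, h7⟩ := h
  generalize hit : I.top j = t at *
  generalize hib : I.bot j = q at *
  have hdt : I.adeg X j t ≤ 1 := by have := hdeg t; rw [hd] at this; simp at this; exact this
  have hdq : I.adeg X j q ≤ 1 := by have := hdeg q; rw [hd] at this; simp at this; exact this
  -- Ends of the same path would be equal or mates.
  have hct : comp t ≠ comp q := by
    rw [Ne, h3 t q hdt hdq]
    rintro (h | h)
    · exact htq h.symm
    · exact hne h.symm
  have hxe := h4 t hdt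
  have hye := h4 q hdq
  have hxm := h5 t hdt
  have hym := h5 q hdq
  have hcx : comp (mate t) = comp t := ((h3 t _ hdt hxe).2 (.inr rfl)).symm
  have hcy : comp (mate q) = comp q := ((h3 q _ hdq hye).2 (.inr rfl)).symm
  have hle : ∀ u, I.adeg X (j + 1) u ≤ 1 → I.adeg X j u ≤ 1 := fun u hu => by rw [hd] at hu; omega
  have hmt := h6 t hdt
  have hmq := h6 q hdq
  have hxt : comp (mate t) ≠ comp (mate q) := by rw [hcx, hcy]; exact hct
  -- the only ends of the new path are the far ends of the two old ones
  have ht' : ∀ u, I.adeg X (j + 1) u ≤ 1 → comp u = comp t → u = mate t := by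
    intro u hu hc
    rcases (h3 t u hdt (hle u hu)).1 hc.symm with rfl | h
    · rw [hd] at hu
      simp only [true_or, if_true] at hu
      exact (hmt.2 (by omega)).symm
    · exact h
  have hq' : ∀ u, I.adeg X (j + 1) u ≤ 1 → comp u = comp q → u = mate q := by
    intro u hu hc
    rcases (h3 q u hdq (hle u hu)).1 hc.symm with rfl | h
    · rw [hd] at hu
      simp only [or_true, if_true] at hu
      exact (hmq.2 (by omega)).symm
    · exact h
  -- The only delicate case is a one-vertex path, `mate t = t`: then the degree rises from zero to
  -- one.
  have hx1 : I.adeg X (j + 1) (mate t) ≤ 1 := by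
    rw [hd]
    have : mate t ≠ q := fun h => hct (by rw [← hcx, h])
    split_ifs with h
    · have := hmt.1 (h.resolve_right this)
      rw [h.resolve_right ‹_›]
      omega
    · exact hxe
  have hy1 : I.adeg X (j + 1) (mate q) ≤ 1 := by
    rw [hd]
    have : mate q ≠ t := fun h => hct (by rw [← hcy, h])
    split_ifs with h
    · have := hmq.1 (h.resolve_left this)
      rw [h.resolve_left ‹_›]
      omega
    · exact hye
  have hx0 : I.adeg X (j + 1) (mate t) ≠ 0 := by
    intro h0
    have h0' : I.adeg X j (mate t) = 0 := by rw [hd] at h0; omega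
    have := (h6 _ hxe).2 h0'
    rw [hxm] at this
    rw [← this, hd] at h0
    simp at h0
  have hy0 : I.adeg X (j + 1) (mate q) ≠ 0 := by
    intro h0
    have h0' : I.adeg X j (mate q) = 0 := by rw [hd] at h0; omega
    have := (h6 _ hye).2 h0'
    rw [hym] at this
    rw [← this, hd] at h0
    simp at h0
  have hxy : mate t ≠ mate q := fun h => hxt (by rw [h])
  have hmx : Function.update (Function.update mate (mate t) (mate q)) (mate q) (mate t) (mate t) =
      mate q := by simp [hxy]
  have hmy : Function.update (Function.update mate (mate t) (mate q)) (mate q) (mate t) (mate q) =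
      mate t := by simp
  have hmu : ∀ u, u ≠ mate t → u ≠ mate q →
      Function.update (Function.update mate (mate t) (mate q)) (mate q) (mate t) u = mate u :=
    fun u h1 h2 => by simp [h1, h2]
  -- the ends of the other paths
  have hother : ∀ u, I.adeg X (j + 1) u ≤ 1 → u ≠ mate t → u ≠ mate q →
      I.adeg X (j + 1) u = I.adeg X j u ∧ I.adeg X (j + 1) (mate u) ≤ 1 ∧ mate u ≠ mate t ∧
      mate u ≠ mate q ∧ comp u ≠ comp t ∧ comp u ≠ comp q := by
    intro u hu hut huq
    have e1 : comp u ≠ comp t := fun h => hut (ht' u hu h)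
    have e2 : comp u ≠ comp q := fun h => huq (hq' u hu h)
    have e3 : comp (mate u) = comp u := ((h3 u _ (hle u hu) (h4 u (hle u hu))).2 (.inr rfl)).symm
    have e4 : mate u ≠ t := by rintro h; rw [h] at e3; exact e1 e3.symm
    have e5 : mate u ≠ q := by rintro h; rw [h] at e3; exact e2 e3.symm
    refine ⟨?_, ?_, fun h => e1 (by rw [← e3, h, hcx]), fun h => e2 (by rw [← e3, h, hcy]), e1, e2⟩
    · have e6 : u ≠ t := fun h => e1 (by rw [h])
      have e7 : u ≠ q := fun h => e2 (by rw [h])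
      simp [hd, e6, e7]
    · have := h4 u (hle u hu)
      simp [hd, e4, e5, this]
  generalize hM : Function.update (Function.update mate (mate t) (mate q)) (mate q) (mate t) = M at *
  refine ⟨fun i hi hai => ?_, fun U hU v hv w hvw => ?_, fun u v hu hv => ?_, fun u hu => ?_,
    fun u hu => ?_, fun u hu => ?_, fun v => ?_⟩
  · rcases Nat.lt_succ_iff_lt_or_eq.1 hi with hi | rfl
    · have := h1 i hi hai
      simp only [this]
    · simp only [hit, hib]
      simp
  · obtain ⟨hU1, hU2⟩ := hcl U hU
    have k := h2 U hU1
    grind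
  · by_cases u1 : u = mate t
    · subst u1
      rw [hmx]
      have := ht' v hv
      have := hq' v hv
      grind
    · by_cases u2 : u = mate q
      · subst u2
        rw [hmy]
        have := ht' v hv
        have := hq' v hv
        grind
      · obtain ⟨o1, o2, o3, o4, o5, o6⟩ := hother u hu u1 u2
        rw [hmu u u1 u2]
        have := h3 u v (hle u hu) (hle v hv)
        grind
  · by_cases u1 : u = mate t
    · rw [u1, hmx]; exact hy1
    · by_cases u2 : u = mate q
      · rw [u2, hmy]; exact hx1
      · rw [hmu u u1 u2]; exact (hother u hu u1 u2).2.1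
  · by_cases u1 : u = mate t
    · rw [u1, hmx, hmy]
    · by_cases u2 : u = mate q
      · rw [u2, hmy, hmx]
      · obtain ⟨o1, o2, o3, o4, o5, o6⟩ := hother u hu u1 u2
        rw [hmu u u1 u2, hmu _ o3 o4, h5 u (hle u hu)]
  · by_cases u1 : u = mate t
    · rw [u1, hmx]; simp [hx0, hxy.symm]
    · by_cases u2 : u = mate q
      · rw [u2, hmy]; simp [hy0, hxy]
      · rw [hmu u u1 u2, (hother u hu u1 u2).1]; exact h6 u (hle u hu)
  · by_cases v1 : comp v = comp t ∨ comp v = comp q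
    · refine ⟨mate t, ?_, hx1⟩
      grind
    · obtain ⟨u, hu, hle⟩ := h7 v
      refine ⟨u, ?_, ?_⟩
      · simp only [hu]
      · have e6 : u ≠ t := fun h => v1 (.inl (by rw [← hu, h]))
        have e7 : u ≠ q := fun h => v1 (.inr (by rw [← hu, h]))
        simpa [hd, e6, e7] using hle

theorem cycInv_zero : I.CycInv X 0 id id := by
  refine ⟨?_, ?_, ?_, ?_, ?_, ?_, fun v => ⟨v, ?_⟩⟩ <;> simp [adeg_zero]
  exact fun u v => eq_comm

/-- An edge joining the two ends of one path turns its component into a cycle. With all degrees at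
most two, no later edge can touch it, so it is a component of the whole active graph. -/
theorem CycInv.conflict {j : ℕ} {mate comp : ℕ → ℕ} (h : I.CycInv X j mate comp) (hj : j < I.m)
    (ha : I.Act X j) (hdeg : ∀ u, I.adeg X I.m u ≤ 2) (he : mate (I.top j) = I.bot j) :
    I.Conflict X (I.bot j) (I.bot j) (I.bot j) := by
  have htq : I.top j ≠ I.bot j := I.disj j j hj hj
  have hd : ∀ u, I.adeg X (j + 1) u = I.adeg X j u + if u = I.top j ∨ u = I.bot j then 1 else 0 := by
    intro u
    rw [adeg_succ]
    simp only [ha, true_and, Inc, eq_comm]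
  have hdm : ∀ u, I.adeg X (j + 1) u ≤ 2 := fun u => (adeg_mono hj u).trans (hdeg u)
  have hdt : I.adeg X j (I.top j) ≤ 1 := by
    have := hdm (I.top j); rw [hd] at this; simp at this; exact this
  have hdq : I.adeg X j (I.bot j) ≤ 1 := by
    have := hdm (I.bot j); rw [hd] at this; simp at this; exact this
  have hmm := h.mate_mate _ hdt
  rw [he] at hmm
  have hct := (h.ends _ _ hdt hdq).2 (.inr he.symm)
  have ht0 : I.adeg X j (I.top j) ≠ 0 := fun h0 =>
    htq (((h.mate_eq _ hdt).2 h0).symm.trans he)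
  have hq0 : I.adeg X j (I.bot j) ≠ 0 := fun h0 =>
    htq (hmm.symm.trans ((h.mate_eq _ hdq).2 h0))
  -- The only vertices of degree at most one in the component were the two ends, of degree one each,
  -- and the new edge raises both.
  have h2 : ∀ u, comp u = comp (I.top j) → 2 ≤ I.adeg X (j + 1) u := by
    intro u hu
    rw [hd]
    by_cases hle : I.adeg X j u ≤ 1
    · have := (h.ends _ u hdt hle).1 hu.symm
      rw [he] at this
      rw [if_pos this]
      rcases this with rfl | rfl <;> omega
    · omega
  have hlast : ∀ u, comp u = comp (I.top j) → ∀ i < I.m, I.Act X i → I.Inc u i → i < j + 1 := by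
    intro u hu i hi hai hinc
    by_contra hc
    have h3 := adeg_mono (I := I) (X := X) (show i + 1 ≤ I.m by omega) u
    rw [adeg_succ, if_pos ⟨hai, hinc⟩] at h3
    have h4 := adeg_mono (I := I) (X := X) (show j + 1 ≤ i by omega) u
    have := h2 u hu
    have := hdeg u
    omega
  have hedge : ∀ i < j + 1, I.Act X i → comp (I.top i) = comp (I.bot i) := by
    intro i hi hai
    rcases Nat.lt_succ_iff_lt_or_eq.1 hi with hi | rfl
    · exact h.edge i hi hai
    · exact hct
  refine conflict_cycle (U := {u | comp u = comp (I.top j)}) hj hdeg ?_ ?_ hct.symm ?_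
  · intro i hi hai
    constructor
    · intro hu
      exact (hedge i (hlast _ hu i hi hai (.inl rfl)) hai).symm.trans hu
    · intro hu
      exact (hedge i (hlast _ hu i hi hai (.inr rfl)) hai).trans hu
  · exact fun u hu => (h2 u hu).trans (adeg_mono hj u)
  · intro V hV u hu huV
    exact h.conn V (fun i hi hai => hV i (by omega) hai) u huV _ (hu.trans hct)

theorem cycScan_inv {j : ℕ} (hj : j ≤ I.m) :
    ((I.cycScan X j).f = 0 → (∀ u, I.adeg X I.m u ≤ 2) ∧
      ∃ comp, I.CycInv X j (I.cycScan X j).mate comp) ∧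
    ((I.cycScan X j).f ≠ 0 →
      I.Conflict X (I.cycScan X j).c₁ (I.cycScan X j).c₂ (I.cycScan X j).c₃) := by
  induction j with
  | zero =>
    have h := degInv_degScan (I := I) (X := X) le_rfl
    refine ⟨fun hf => ⟨h.free hf, id, ?_⟩, h.conflict⟩
    rw [cycScan, h.mate]
    exact cycInv_zero
  | succ j ih =>
    obtain ⟨ih1, ih2⟩ := ih (by omega)
    rw [cycScan]
    split_ifs with ha
    swap
    · refine ⟨fun hf => ?_, ih2⟩
      obtain ⟨hdeg, comp, h1, h2, h3, h4, h5, h6, h7⟩ := ih1 hf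
      have hd : ∀ u, I.adeg X (j + 1) u = I.adeg X j u := fun u => by simp [adeg_succ, ha]
      refine ⟨hdeg, comp, fun i hi hai => ?_, fun U hU => h2 U fun i hi => hU i (by omega), ?_, ?_, ?_,
        ?_, ?_⟩ <;> try simp only [hd]
      · rcases Nat.lt_succ_iff_lt_or_eq.1 hi with hi | rfl
        · exact h1 i hi hai
        · exact absurd hai ha
      all_goals assumption
    · generalize I.cycScan X j = S at *
      unfold Scan.link
      by_cases hf : S.f < 1
      · obtain ⟨hdeg, comp, h⟩ := ih1 (by omega)
        by_cases he : S.mate (I.top j) = I.bot j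
        · simp only [hf, he, if_true]
          exact ⟨fun h => absurd h one_ne_zero, fun _ => h.conflict hj ha hdeg he⟩
        · simp only [hf, he, if_true, if_false]
          exact ⟨fun _ => ⟨hdeg, _, h.link hj ha
            (fun u => (adeg_mono hj u).trans (hdeg u)) he⟩, fun h => absurd h (by omega)⟩
      · simp only [hf, if_false]
        exact ⟨fun h => absurd h (by omega), ih2⟩

/-- A nonempty closed set contains an entire component, and every component has an end of degree at
most one. -/
theorem linForest_of_scan (h : (I.scan X).f = 0) : I.LinForest X := by
  obtain ⟨hdeg, comp, hc⟩ := (cycScan_inv (I := I) (X := X) le_rfl).1 h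
  refine ⟨hdeg, fun U ⟨v, hv⟩ hU => ?_⟩
  obtain ⟨u, hu, hle⟩ := hc.exists_end v
  exact ⟨u, hc.conn U hU v hv u hu.symm, hle⟩

theorem conflict_of_scan (h : (I.scan X).f ≠ 0) :
    I.Conflict X (I.scan X).c₁ (I.scan X).c₂ (I.scan X).c₃ :=
  (cycScan_inv (I := I) (X := X) le_rfl).2 h

/-! ### The search tree -/

/-- The vertices chosen after `r` steps, if the choice at step `r` is the `d r`-th vertex of the
conflict found. -/
def chosen (I : EdgeList) (d : ℕ → ℕ) : ℕ → Finset ℕ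
  | 0 => ∅
  | r + 1 => if (I.scan (chosen I d r)).f = 0 then chosen I d r else
      insert (if d r < 1 then (I.scan (chosen I d r)).c₁ else
        if d r < 2 then (I.scan (chosen I d r)).c₂ else (I.scan (chosen I d r)).c₃) (chosen I d r)

/-- The choices `d` lead to a solution with at most `k` vertices. -/
def Accepts (I : EdgeList) (d : ℕ → ℕ) (k : ℕ) : Prop :=
  ∃ r ≤ k, (I.scan (I.chosen d r)).f = 0

theorem chosen_congr {d d' : ℕ → ℕ} {r : ℕ} (h : ∀ i < r, d i = d' i) :
    I.chosen d r = I.chosen d' r := by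
  induction r with
  | zero => rfl
  | succ r ih => rw [chosen, chosen, ih fun i hi => h i (by omega), h r (by omega)]

theorem accepts_congr {d d' : ℕ → ℕ} {k : ℕ} (h : ∀ i < k, d i = d' i) :
    I.Accepts d k ↔ I.Accepts d' k := by
  unfold Accepts
  refine exists_congr fun r => and_congr_right fun hr => ?_
  rw [chosen_congr fun i hi => h i (by omega)]

theorem card_chosen_le (d : ℕ → ℕ) (r : ℕ) : (I.chosen d r).card ≤ r := by
  induction r with
  | zero => simp [chosen]
  | succ r ih =>
    rw [chosen]
    split_ifs
    · omega
    all_goals exact (Finset.card_insert_le _ _).trans (by omega)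

/-- Induction on the remaining budget `n`: a conflict always allows one of its three vertices to be
added at the cost of one unit, and with no budget left there can be no conflict. -/
theorem exists_accepting (n : ℕ) : ∀ (r : ℕ) (d : ℕ → ℕ), (∀ i, d i < 3) →
    I.Solvable (I.chosen d r) n →
    ∃ d', (∀ i, d' i < 3) ∧ ∃ r' ≤ r + n, (I.scan (I.chosen d' r')).f = 0 := by
  induction n with
  | zero =>
    intro r d hd hs
    refine ⟨d, hd, r, le_rfl, ?_⟩
    by_contra hf
    obtain ⟨r', hr', -⟩ := conflict_of_scan hf 0 hs
    omega
  | succ n ih =>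
    intro r d hd hs
    by_cases hf : (I.scan (I.chosen d r)).f = 0
    · exact ⟨d, hd, r, by omega, hf⟩
    · obtain ⟨r', hr', hs'⟩ := conflict_of_scan hf _ hs
      obtain rfl : n = r' := by omega
      have key : ∀ v < 3, I.Solvable (insert (if v < 1 then (I.scan (I.chosen d r)).c₁ else
          if v < 2 then (I.scan (I.chosen d r)).c₂ else (I.scan (I.chosen d r)).c₃)
          (I.chosen d r)) n →
          ∃ d', (∀ i, d' i < 3) ∧ ∃ r' ≤ r + (n + 1), (I.scan (I.chosen d' r')).f = 0 := by
        intro v hv hsv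
        -- Choices before step `r` are unaffected by fixing the digit `r`.
        have hc : I.chosen (Function.update d r v) r = I.chosen d r :=
          chosen_congr fun i hi => by simp [hi.ne]
        obtain ⟨d', hd', r', hr', h⟩ := ih (r + 1) (Function.update d r v)
          (fun i => by rw [Function.update_apply]; split_ifs <;> simp [hv, hd]) (by
            rw [chosen, hc, if_neg hf, Function.update_self]
            exact hsv)
        exact ⟨d', hd', r', by omega, h⟩
      rcases hs' with hs' | hs' | hs'
      · exact key 0 (by omega) (by simpa using hs')
      · exact key 1 (by omega) (by simpa using hs')
      · exact key 2 (by omega) (by simpa using hs')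

theorem exists_accepts_iff (k : ℕ) :
    (∃ d : ℕ → ℕ, (∀ i, d i < 3) ∧ I.Accepts d k) ↔
      ∃ X : Finset ℕ, X.card ≤ k ∧ I.LinForest X := by
  constructor
  · rintro ⟨d, -, r, hr, h⟩
    exact ⟨_, (card_chosen_le d r).trans hr, linForest_of_scan h⟩
  · rintro ⟨X, hX, h⟩
    obtain ⟨d, hd, r, hr, h⟩ := exists_accepting (I := I) k 0 (fun _ => 0) (by simp)
      ⟨X, hX, by simpa [chosen] using h⟩
    exact ⟨d, hd, r, by omega, h⟩

end EdgeList

end BipartiteSplit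

namespace BipartiteSplit

/-! ### Reasoning about programs -/

@[simp] theorem State.reg_setReg (s : State) (x v : ℕ) :
    (s.setReg x v).reg = Function.update s.reg x v := rfl

@[simp] theorem State.arr_setReg (s : State) (x v : ℕ) : (s.setReg x v).arr = s.arr := rfl

@[simp] theorem State.reg_setCell (s : State) (A i v : ℕ) : (s.setCell A i v).reg = s.reg := rfl

@[simp] theorem State.arr_setCell (s : State) (A i v : ℕ) :
    (s.setCell A i v).arr = Function.update s.arr A (Function.update (s.arr A) i v) := rfl

/-- All numbers in memory are less than `W`. -/
def State.Bounded (W : ℕ) (s : State) : Prop := (∀ r, s.reg r < W) ∧ ∀ A i, s.arr A i < W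

theorem State.Bounded.setReg {W : ℕ} {s : State} (h : s.Bounded W) (x : ℕ) {v : ℕ} (hv : v < W) :
    (s.setReg x v).Bounded W := by
  refine ⟨fun r => ?_, h.2⟩
  rw [State.reg_setReg, Function.update_apply]
  split_ifs
  · exact hv
  · exact h.1 r

theorem State.Bounded.setCell {W : ℕ} {s : State} (h : s.Bounded W) (A i : ℕ) {v : ℕ} (hv : v < W) :
    (s.setCell A i v).Bounded W := by
  refine ⟨h.1, fun B j => ?_⟩
  rw [State.arr_setCell, Function.update_apply]
  split_ifs
  · rw [Function.update_apply]
    split_ifs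
    · exact hv
    · exact h.2 A j
  · exact h.2 B j

namespace Prog

/-- The registers a program may write to. -/
def regs : Prog → List ℕ
  | skip => []
  | const x _ => [x]
  | op _ x _ _ => [x]
  | load x _ _ => [x]
  | store _ _ _ => []
  | seq p q => p.regs ++ q.regs
  | ifLt _ _ p q => p.regs ++ q.regs
  | whileLt _ _ p => p.regs

/-- The arrays a program may write to. -/
def arrs : Prog → List ℕ
  | skip => []
  | const _ _ => []
  | op _ _ _ _ => []
  | load _ _ _ => []
  | store A _ _ => [A]
  | seq p q => p.arrs ++ q.arrs
  | ifLt _ _ p q => p.arrs ++ q.arrs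
  | whileLt _ _ p => p.arrs

/-- A bound on the number of steps of a program without loops. -/
def cost : Prog → ℕ
  | seq p q => p.cost + q.cost
  | ifLt _ _ p q => max p.cost q.cost + 1
  | _ => 1

/-- `s'` agrees with `s` outside of the registers and arrays that `p` may write to. -/
def Frame (p : Prog) (s s' : State) : Prop :=
  (∀ r, r ∉ p.regs → s'.reg r = s.reg r) ∧ ∀ A, A ∉ p.arrs → s'.arr A = s.arr A

/-- The weakest precondition of a program without loops. -/
def wp (W : ℕ) : Prog → State → (State → Prop) → Prop
  | skip, s, Q => Q s
  | const x c, s, Q => c < W ∧ Q (s.setReg x c)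
  | op o x y z, s, Q => (s.Bounded W → o.eval (s.reg y) (s.reg z) < W) ∧
      Q (s.setReg x (o.eval (s.reg y) (s.reg z)))
  | load x A y, s, Q => Q (s.setReg x (s.arr A (s.reg y)))
  | store A x y, s, Q => Q (s.setCell A (s.reg x) (s.reg y))
  | seq p q, s, Q => wp W p s fun s' => wp W q s' Q
  | ifLt x y p q, s, Q => (s.reg x < s.reg y → wp W p s Q) ∧ (¬ s.reg x < s.reg y → wp W q s Q)
  | whileLt _ _ _, _, _ => False

/-- `x := y`, if register `4` holds `0`. -/
abbrev mov (x y : ℕ) : Prog := op .add x y 4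

/-- `for x := 0 to n - 1 do p`, if register `5` holds `1`. -/
def forLoop (x n : ℕ) (p : Prog) : Prog :=
  seq (const x 0) (whileLt x n (seq p (op .add x x 5)))

end Prog

open Prog

variable {W : ℕ} {p q : Prog} {s s' : State} {t : ℕ}

/-- Since memory never exceeds a word, loads and stores need no overflow check in `wp`, and the
check for arithmetic may assume boundedness. -/
theorem Exec.bounded (h : Exec W p s t s') (hs : s.Bounded W) : s'.Bounded W := by
  induction h with
  | skip => exact hs
  | const s x c h => exact hs.setReg x h
  | op s o x y z h => exact hs.setReg x h
  | load s x A y h => exact hs.setReg x h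
  | store s A x y h => exact hs.setCell A _ h.2
  | seq _ _ ihp ihq => exact ihq (ihp hs)
  | ifTrue _ _ _ _ ih => exact ih hs
  | ifFalse _ _ _ _ ih => exact ih hs
  | whileFalse => exact hs
  | whileTrue _ _ _ _ _ ihp ihw => exact ihw (ihp hs)

theorem Exec.frame (h : Exec W p s t s') : p.Frame s s' := by
  induction h with
  | skip => exact ⟨fun _ _ => rfl, fun _ _ => rfl⟩
  | const s x c h => exact ⟨fun r hr => by simp_all [regs], fun _ _ => rfl⟩
  | op s o x y z h => exact ⟨fun r hr => by simp_all [regs], fun _ _ => rfl⟩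
  | load s x A y h => exact ⟨fun r hr => by simp_all [regs], fun _ _ => rfl⟩
  | store s A x y h => exact ⟨fun _ _ => rfl, fun A hA => by simp_all [arrs]⟩
  | seq _ _ ihp ihq =>
    refine ⟨fun r hr => ?_, fun A hA => ?_⟩
    · simp only [regs, List.mem_append, not_or] at hr
      rw [ihq.1 r hr.2, ihp.1 r hr.1]
    · simp only [arrs, List.mem_append, not_or] at hA
      rw [ihq.2 A hA.2, ihp.2 A hA.1]
  | ifTrue _ _ _ _ ih =>
    refine ⟨fun r hr => ?_, fun A hA => ?_⟩
    · simp only [regs, List.mem_append, not_or] at hr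
      exact ih.1 r hr.1
    · simp only [arrs, List.mem_append, not_or] at hA
      exact ih.2 A hA.1
  | ifFalse _ _ _ _ ih =>
    refine ⟨fun r hr => ?_, fun A hA => ?_⟩
    · simp only [regs, List.mem_append, not_or] at hr
      exact ih.1 r hr.2
    · simp only [arrs, List.mem_append, not_or] at hA
      exact ih.2 A hA.2
  | whileFalse => exact ⟨fun _ _ => rfl, fun _ _ => rfl⟩
  | whileTrue _ _ _ _ _ ihp ihw =>
    exact ⟨fun r hr => by rw [ihw.1 r hr, ihp.1 r hr], fun A hA => by rw [ihw.2 A hA, ihp.2 A hA]⟩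

theorem Prog.wp_sound {Q : State → Prop} (hs : s.Bounded W) (h : p.wp W s Q) :
    ∃ t s', Exec W p s t s' ∧ t ≤ p.cost ∧ Q s' := by
  induction p generalizing s Q with
  | skip => exact ⟨1, s, .skip s, le_rfl, h⟩
  | const x c => exact ⟨1, _, .const s x c h.1, le_rfl, h.2⟩
  | op o x y z => exact ⟨1, _, .op s o x y z (h.1 hs), le_rfl, h.2⟩
  | load x A y => exact ⟨1, _, .load s x A y (hs.2 _ _), le_rfl, h⟩
  | store A x y => exact ⟨1, _, .store s A x y ⟨hs.1 _, hs.1 _⟩, le_rfl, h⟩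
  | seq p q ihp ihq =>
    obtain ⟨t₁, s₁, h₁, hc₁, h₂⟩ := ihp hs h
    obtain ⟨t₂, s₂, h₂, hc₂, hQ⟩ := ihq (h₁.bounded hs) h₂
    exact ⟨_, s₂, .seq h₁ h₂, add_le_add hc₁ hc₂, hQ⟩
  | ifLt x y p q ihp ihq =>
    by_cases hc : s.reg x < s.reg y
    · obtain ⟨t, s', h₁, hc₁, hQ⟩ := ihp hs (h.1 hc)
      exact ⟨_, s', .ifTrue x y hc h₁, by simp only [cost]; omega, hQ⟩
    · obtain ⟨t, s', h₁, hc₁, hQ⟩ := ihq hs (h.2 hc)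
      exact ⟨_, s', .ifFalse x y hc h₁, by simp only [cost]; omega, hQ⟩
  | whileLt => exact h.elim

/-- Started in `s`, the program `p` halts within `n` steps in a state satisfying `Q`. -/
def Runs (W : ℕ) (p : Prog) (s : State) (n : ℕ) (Q : State → Prop) : Prop :=
  ∃ t s', Exec W p s t s' ∧ t ≤ n ∧ Q s'

namespace Runs

variable {n n₁ n₂ : ℕ} {Q Q' : State → Prop}

theorem of_wp (hs : s.Bounded W) (h : p.wp W s Q) : Runs W p s p.cost Q := wp_sound hs h

theorem mono (h : Runs W p s n₁ Q) (hn : n₁ ≤ n₂) (hQ : ∀ s', Q s' → Q' s') : Runs W p s n₂ Q' := by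
  obtain ⟨t, s', he, ht, hq⟩ := h
  exact ⟨t, s', he, ht.trans hn, hQ s' hq⟩

theorem frame (hs : s.Bounded W) (h : Runs W p s n Q) :
    Runs W p s n fun s' => s'.Bounded W ∧ p.Frame s s' ∧ Q s' := by
  obtain ⟨t, s', he, ht, hq⟩ := h
  exact ⟨t, s', he, ht, he.bounded hs, he.frame, hq⟩

theorem seq (hs : s.Bounded W) (hp : Runs W p s n₁ Q')
    (hq : ∀ s₁, s₁.Bounded W → p.Frame s s₁ → Q' s₁ → Runs W q s₁ n₂ Q) :
    Runs W (.seq p q) s (n₁ + n₂) Q := by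
  obtain ⟨t₁, s₁, he, ht, hb, hf, h⟩ := hp.frame hs
  obtain ⟨t₂, s₂, he₂, ht₂, h₂⟩ := hq s₁ hb hf h
  exact ⟨_, s₂, .seq he he₂, add_le_add ht ht₂, h₂⟩

/-- The measure drops in each iteration, which costs at most `c` steps and one test; the final `1`
is the failing test. The frame hypothesis spares the invariant from mentioning untouched memory. -/
theorem while_loop {x y c : ℕ} {Inv : State → Prop} (μ : State → ℕ) (hs : s.Bounded W) (h0 : Inv s)
    (hstep : ∀ s₁, s₁.Bounded W → p.Frame s s₁ → Inv s₁ → s₁.reg x < s₁.reg y →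
      Runs W p s₁ c fun s₂ => Inv s₂ ∧ μ s₂ < μ s₁) :
    Runs W (.whileLt x y p) s ((c + 1) * μ s + 1) fun s' => Inv s' ∧ ¬ s'.reg x < s'.reg y := by
  suffices ∀ n s₁, μ s₁ = n → s₁.Bounded W → p.Frame s s₁ → Inv s₁ →
      Runs W (.whileLt x y p) s₁ ((c + 1) * n + 1) fun s' => Inv s' ∧ ¬ s'.reg x < s'.reg y from
    this _ s rfl hs ⟨fun _ _ => rfl, fun _ _ => rfl⟩ h0
  intro n
  induction n using Nat.strong_induction_on with
  | _ n ih =>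
    intro s₁ hn hb hf hI
    by_cases hlt : s₁.reg x < s₁.reg y
    · obtain ⟨t₁, s₂, he, ht, hb₂, hf₂, hI₂, hμ⟩ := (hstep s₁ hb hf hI hlt).frame hb
      obtain ⟨t₂, s₃, he₃, ht₃, h₃⟩ := ih (μ s₂) (hn ▸ hμ) s₂ rfl hb₂
        ⟨fun r hr => by rw [hf₂.1 r hr, hf.1 r hr], fun A hA => by rw [hf₂.2 A hA, hf.2 A hA]⟩ hI₂
      refine ⟨_, s₃, .whileTrue x y hlt he he₃, ?_, h₃⟩
      have : (c + 1) * (μ s₂ + 1) ≤ (c + 1) * n := Nat.mul_le_mul_left _ (by omega)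
      rw [mul_add] at this
      omega
    · exact ⟨1, s₁, .whileFalse x y hlt, by omega, hI, hlt⟩

/-- Each round costs the body, the increment and the test; the last `2` covers the initialization
and the failing test. The increment cannot overflow, as the index is below the bound in register
`y`. -/
theorem for_loop {x y c N : ℕ} {Inv : ℕ → State → Prop} (hs : s.Bounded W) (hN : s.reg y = N)
    (h1 : s.reg 5 = 1) (hx : x ∉ p.regs) (hy : y ∉ p.regs) (h5 : 5 ∉ p.regs) (hxy : x ≠ y)
    (hx5 : x ≠ 5) (h0 : Inv 0 (s.setReg x 0))
    (hstep : ∀ j s₁, j < N → s₁.Bounded W → (forLoop x y p).Frame s s₁ → s₁.reg x = j → Inv j s₁ →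
      Runs W p s₁ c fun s₂ => Inv (j + 1) (s₂.setReg x (j + 1))) :
    Runs W (forLoop x y p) s ((c + 2) * N + 2) fun s' => Inv N s' := by
  have hW : 0 < W := (Nat.zero_le _).trans_lt (hs.1 0)
  have hframe : ∀ {s₁ : State}, (Prog.seq p (op .add x x 5)).Frame (s.setReg x 0) s₁ →
      (forLoop x y p).Frame s s₁ := by
    intro s₁ hf
    refine ⟨fun r hr => ?_, fun A hA => ?_⟩
    · simp only [forLoop, regs, List.mem_append, List.mem_cons, not_or] at hr
      rw [hf.1 r (by simp [regs, hr])]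
      simp [hr.1.1]
    · simp only [forLoop, arrs, List.mem_append, List.nil_append] at hA
      exact hf.2 A (by simpa [arrs] using hA)
  have key := while_loop (W := W) (p := Prog.seq p (op .add x x 5)) (s := s.setReg x 0) (x := x)
    (y := y) (c := c + 1) (Inv := fun s₁ => Inv (s₁.reg x) s₁ ∧ s₁.reg x ≤ N ∧ s₁.reg y = N ∧
      s₁.reg 5 = 1) (fun s₁ => N - s₁.reg x) (hs.setReg x hW)
    (by simp [h0, hxy.symm, hx5.symm, hN, h1]) (by
      rintro s₁ hb hf ⟨hI, hle, hy₁, h5₁⟩ hlt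
      refine (seq hb (hstep _ s₁ (by omega) hb (hframe hf) rfl hI) (n₂ := 1) (fun s₂ hb₂ hf₂ hI₂ => ?_))
      have e1 := hf₂.1 x hx
      have e2 := hf₂.1 y hy
      have e3 := hf₂.1 5 h5
      refine of_wp hb₂ ⟨fun _ => ?_, ?_⟩
      · have := hb.1 y
        simp only [Op.eval]
        omega
      · simp only [Op.eval, e1, e3, h5₁, State.reg_setReg, Function.update_self]
        refine ⟨⟨hI₂, by omega, ?_, ?_⟩, by omega⟩
        · simp [hxy.symm, e2, hy₁]
        · simp [hx5.symm, e3, h5₁])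
  obtain ⟨t, s', he, ht, ⟨hI, hle, hy', -⟩, hlt⟩ := key
  refine ⟨_, s', .seq (.const s x 0 hW) he, ?_, ?_⟩
  · simp only [State.reg_setReg, Function.update_self, Nat.sub_zero] at ht
    rw [show c + 1 + 1 = c + 2 from rfl] at ht
    omega
  · rwa [show s'.reg x = N by omega] at hI

end Runs

end BipartiteSplit

namespace BipartiteSplit

open Prog EdgeList

/-! ### The program

Registers: `2` number of edges, `3` the parameter, `4`, `5`, `6` the constants `0`, `1`, `2`,
`7` loop index, `8`, `9` ends of the current edge, `10`, `11` auxiliary, `13` conflict flag,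
`14`, `15`, `16` the conflict, `17` search depth, `18` success flag, `19` search depth bound,
`20` carry, `21` continuation flag.
Arrays: `0`, `1` ends of the edges, `2` degrees, `3` chosen vertices, `4` active degrees,
`5`, `6` first and second neighbours, `7` other ends of paths, `8` choices. -/

/-- Process one edge in `initProg`. -/
def initBody : Prog :=
  seq (load 8 0 7) <| seq (load 9 1 7) <| seq (op .add 9 0 9) <| seq (store 1 7 9) <|
  seq (load 10 2 8) <| seq (op .add 10 10 5) <| seq (store 2 8 10) <|
  seq (load 10 2 9) <| seq (op .add 10 10 5) <| store 2 9 10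

/-- Shift the numbers of the bottom vertices and compute the degrees. -/
def initProg : Prog :=
  seq (seq (const 4 0) <| seq (const 5 1) <| const 6 2) <| forLoop 7 2 initBody

/-- Unmark the bottom end of one edge. -/
def clearBody : Prog := seq (load 9 1 7) (store 3 9 4)

/-- Reset the scan data at the ends of one edge. -/
def resetBody : Prog :=
  seq (load 8 0 7) <| seq (load 9 1 7) <| seq (store 4 8 4) <| seq (store 4 9 4) <|
  seq (store 5 8 4) <| seq (store 5 9 4) <| seq (store 6 8 4) <| seq (store 6 9 4) <|
  seq (store 7 8 8) <| store 7 9 9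

/-- Load the current edge and run `p` if it is active. -/
def ifAct (p : Prog) : Prog :=
  seq (load 8 0 7) <| seq (load 9 1 7) <|
  seq (load 10 2 8) <| ifLt 5 10 (seq (load 10 2 9) <| ifLt 5 10 (seq (load 10 3 9) <|
    ifLt 10 5 p skip) skip) skip

/-- The program for `Scan.noteTop`. -/
def noteTopProg : Prog :=
  seq (load 10 4 8) <|
  seq (ifLt 10 6 (ifLt 10 5 (store 5 8 9) (store 6 8 9))
    (seq (load 14 5 8) <| seq (load 15 6 8) <| seq (mov 16 9) <| const 13 1)) <|
  seq (op .add 10 10 5) <| store 4 8 10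

/-- Report the current bottom vertex as conflict. -/
def foundProg : Prog := seq (mov 14 9) <| seq (mov 15 9) <| seq (mov 16 9) <| const 13 1

/-- The program for `Scan.noteBot`. -/
def noteBotProg : Prog :=
  seq (load 10 4 9) <| seq (ifLt 10 6 skip foundProg) <| seq (op .add 10 10 5) <| store 4 9 10

/-- Join two paths. -/
def joinProg : Prog := seq (load 11 7 9) <| seq (store 7 10 11) <| store 7 11 10

/-- The program for `Scan.link`. -/
def linkProg : Prog :=
  ifLt 13 5 (seq (load 10 7 8) <| ifLt 10 9 joinProg <| ifLt 9 10 joinProg foundProg) skip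

/-- The program for `EdgeList.scan`. -/
def scanProg : Prog :=
  seq (seq (const 13 0) <| seq (const 14 0) <| seq (const 15 0) <| const 16 0) <|
  seq (forLoop 7 2 resetBody) <|
  seq (forLoop 7 2 (ifAct (seq noteTopProg noteBotProg))) <| forLoop 7 2 (ifAct linkProg)

/-- Record success, or mark the chosen vertex of the conflict. -/
def chooseProg : Prog :=
  ifLt 13 5 (const 18 1) <| seq (load 10 8 17) <|
    ifLt 10 5 (store 3 14 5) <| ifLt 10 6 (store 3 15 5) (store 3 16 5)

/-- Follow one sequence of choices. -/
def searchProg : Prog := forLoop 17 19 (seq scanProg chooseProg)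

/-- Process one digit in `nextProg`. -/
def nextBody : Prog :=
  seq (load 10 8 7) <| ifLt 4 20 (ifLt 10 6
    (seq (op .add 10 10 5) <| seq (store 8 7 10) <| const 20 0) (store 8 7 4)) skip

/-- Proceed to the next sequence of choices. -/
def nextProg : Prog :=
  seq (const 20 1) <| seq (forLoop 7 3 nextBody) <| op .sub 21 5 20

/-- Decide CRSV by trying all sequences of choices. -/
def crsvProg : Prog :=
  seq initProg <| seq (seq (const 21 1) <| seq (const 18 0) <| op .add 19 3 5) <|
  seq (whileLt 4 21 (seq (forLoop 7 2 clearBody) <| seq searchProg nextProg)) <| mov 0 18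

/-! ### Specifications -/

/-- The memory contents that are fixed after the initialization. -/
structure Ready (I : EdgeList) (k : ℕ) (s : State) : Prop where
  m : s.reg 2 = I.m
  k : s.reg 3 = k
  zero : s.reg 4 = 0
  one : s.reg 5 = 1
  two : s.reg 6 = 2
  top : ∀ i < I.m, s.arr 0 i = I.top i
  bot : ∀ i < I.m, s.arr 1 i = I.bot i
  deg : ∀ u, s.arr 2 u = I.deg u

/-- Array `3` marks the vertices in `X`. -/
def Marks (I : EdgeList) (X : Finset ℕ) (s : State) : Prop :=
  ∀ i < I.m, s.arr 3 (I.bot i) = if I.bot i ∈ X then 1 else 0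

/-- `u` is an end of an edge. -/
def EdgeList.IsVertex (I : EdgeList) (u : ℕ) : Prop := ∃ i < I.m, I.Inc u i

/-- The memory holds the data of the scan `S`. -/
structure Holds (I : EdgeList) (S : Scan) (s : State) : Prop where
  cnt : ∀ u, I.IsVertex u → s.arr 4 u = S.cnt u
  n₁ : ∀ u, I.IsVertex u → s.arr 5 u = S.n₁ u
  n₂ : ∀ u, I.IsVertex u → s.arr 6 u = S.n₂ u
  mate : ∀ u, I.IsVertex u → s.arr 7 u = S.mate u
  f : s.reg 13 = S.f
  c₁ : s.reg 14 = S.c₁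
  c₂ : s.reg 15 = S.c₂
  c₃ : s.reg 16 = S.c₃

variable {W k : ℕ} {I : EdgeList} {X : Finset ℕ} {S : Scan} {s s' : State}

theorem Ready.of_eq (h : Ready I k s) (hr : ∀ r ∈ [2, 3, 4, 5, 6], s'.reg r = s.reg r)
    (hA : ∀ A ∈ [0, 1, 2], s'.arr A = s.arr A) : Ready I k s' := by
  simp only [List.forall_mem_cons] at hr hA
  obtain ⟨h1, h2, h3, h4, h5, -⟩ := hr
  obtain ⟨h6, h7, h8, -⟩ := hA
  constructor <;> simp only [*]
  exacts [h.m, h.k, h.zero, h.one, h.two, h.top, h.bot, h.deg]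

theorem Ready.of_frame {p : Prog} (h : Ready I k s) (hf : p.Frame s s')
    (hr : ∀ r ∈ [2, 3, 4, 5, 6], r ∉ p.regs) (hA : ∀ A ∈ [0, 1, 2], A ∉ p.arrs) : Ready I k s' :=
  h.of_eq (fun r h => hf.1 r (hr r h)) fun A h => hf.2 A (hA A h)

theorem EdgeList.isVertex_top {i : ℕ} (hi : i < I.m) : I.IsVertex (I.top i) := ⟨i, hi, .inl rfl⟩

theorem EdgeList.isVertex_bot {i : ℕ} (hi : i < I.m) : I.IsVertex (I.bot i) := ⟨i, hi, .inr rfl⟩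

theorem Holds.setReg (h : Holds I S s) {x v : ℕ} (hx : x ∉ [13, 14, 15, 16]) :
    Holds I S (s.setReg x v) := by
  simp only [List.mem_cons, List.not_mem_nil, or_false, not_or] at hx
  obtain ⟨h1, h2, h3, h4, h5, h6, h7, h8⟩ := h
  refine ⟨h1, h2, h3, h4, ?_, ?_, ?_, ?_⟩ <;>
    rw [State.reg_setReg, Function.update_of_ne (by omega)] <;> assumption

theorem Holds.of_eq (h : Holds I S s) (hr : ∀ r ∈ [13, 14, 15, 16], s'.reg r = s.reg r)
    (hA : ∀ A ∈ [4, 5, 6, 7], s'.arr A = s.arr A) : Holds I S s' := by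
  simp only [List.forall_mem_cons] at hr hA
  obtain ⟨h1, h2, h3, h4, -⟩ := hr
  obtain ⟨h5, h6, h7, h8, -⟩ := hA
  constructor <;> simp only [*]
  exacts [h.cnt, h.n₁, h.n₂, h.mate, h.f, h.c₁, h.c₂, h.c₃]

theorem Marks.of_eq (h : Marks I X s) (hA : s'.arr 3 = s.arr 3) : Marks I X s' := by
  unfold Marks
  rwa [hA]

/-- The hypothesis `hc` keeps the incremented counter within a word, because `I.m` itself is stored
in a register. -/
theorem wp_noteTopProg {j : ℕ} (hj : j < I.m) (hW : 2 < W) (hs : s.Bounded W) (hR : Ready I k s)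
    (hH : Holds I S s) (h8 : s.reg 8 = I.top j) (h9 : s.reg 9 = I.bot j)
    (hc : S.cnt (I.top j) < I.m) :
    noteTopProg.wp W s (Holds I (S.noteTop (I.top j) (I.bot j))) := by
  have e1 := hH.cnt _ (isVertex_top hj)
  have e2 := hH.n₁ _ (isVertex_top hj)
  have e3 := hH.n₂ _ (isVertex_top hj)
  have hmW : I.m < W := hR.m ▸ hs.1 2
  have hbW : I.bot j < W := h9 ▸ hs.1 9
  unfold Scan.noteTop
  by_cases h1 : S.cnt (I.top j) < 2 <;> by_cases h2 : S.cnt (I.top j) < 1 <;>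
    simp only [noteTopProg, wp, Op.eval, State.reg_setReg, State.arr_setReg, State.reg_setCell,
      Function.update_self, Function.update_of_ne, ne_eq, if_true, if_false,
      Nat.reduceEqDiff, not_false_eq_true, h8, h9, e1, e2, e3, hR.zero, hR.one, hR.two, h1, h2,
      forall_true_left, not_true_eq_false, false_implies, true_and, and_true, add_zero, hbW,
      implies_true]
  · refine ⟨fun _ => by omega, ?_⟩
    constructor <;> (try intro u hu) <;>
      simp [Function.update_apply, hH.cnt, hH.n₁, hH.n₂, hH.mate, hH.f, hH.c₁, hH.c₂, hH.c₃, *]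
  · refine ⟨fun _ => by omega, ?_⟩
    constructor <;> (try intro u hu) <;>
      simp [Function.update_apply, hH.cnt, hH.n₁, hH.n₂, hH.mate, hH.f, hH.c₁, hH.c₂, hH.c₃, *]
  · omega
  · refine ⟨by omega, fun _ => by omega, ?_⟩
    constructor <;> (try intro u hu) <;>
      simp [Function.update_apply, hH.cnt, hH.n₁, hH.n₂, hH.mate, hH.f, hH.c₁, hH.c₂, hH.c₃, *]

theorem wp_noteBotProg {j : ℕ} (hj : j < I.m) (hW : 2 < W) (hs : s.Bounded W) (hR : Ready I k s)
    (hH : Holds I S s) (h9 : s.reg 9 = I.bot j) (hc : S.cnt (I.bot j) < I.m) :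
    noteBotProg.wp W s (Holds I (S.noteBot (I.bot j))) := by
  have e1 := hH.cnt _ (isVertex_bot hj)
  have hmW : I.m < W := hR.m ▸ hs.1 2
  have hbW : I.bot j < W := h9 ▸ hs.1 9
  unfold Scan.noteBot
  by_cases h1 : S.cnt (I.bot j) < 2 <;>
    simp only [noteBotProg, foundProg, wp, Op.eval, State.reg_setReg, State.arr_setReg,
      Function.update_self, Function.update_of_ne, ne_eq, if_true, if_false,
      Nat.reduceEqDiff, not_false_eq_true, h9, e1, hR.zero, hR.one, hR.two, h1,
      forall_true_left, not_true_eq_false, false_implies, true_and, and_true, add_zero, hbW,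
      implies_true]
  · refine ⟨fun _ => by omega, ?_⟩
    constructor <;> (try intro u hu) <;>
      simp [Function.update_apply, hH.cnt, hH.n₁, hH.n₂, hH.mate, hH.f, hH.c₁, hH.c₂, hH.c₃, *]
  · refine ⟨by omega, fun _ => by omega, ?_⟩
    constructor <;> (try intro u hu) <;>
      simp [Function.update_apply, hH.cnt, hH.n₁, hH.n₂, hH.mate, hH.f, hH.c₁, hH.c₂, hH.c₃, *]

theorem wp_linkProg {j : ℕ} (hj : j < I.m) (hW : 2 < W) (hs : s.Bounded W) (hR : Ready I k s)
    (hH : Holds I S s) (h8 : s.reg 8 = I.top j) (h9 : s.reg 9 = I.bot j) :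
    linkProg.wp W s (Holds I (S.link (I.top j) (I.bot j))) := by
  have e1 := hH.mate _ (isVertex_top hj)
  have e2 := hH.mate _ (isVertex_bot hj)
  have hbW : I.bot j < W := h9 ▸ hs.1 9
  unfold Scan.link
  by_cases h1 : S.f < 1
  · rcases lt_trichotomy (S.mate (I.top j)) (I.bot j) with h2 | h2 | h2
    · have h3 : S.mate (I.top j) ≠ I.bot j := h2.ne
      simp only [linkProg, joinProg, wp, State.reg_setReg, State.arr_setReg,
        State.reg_setCell, Function.update_self, Function.update_of_ne, ne_eq, if_true, if_false,
        Nat.reduceEqDiff, not_false_eq_true, h8, h9, e1, e2, hR.one, h1, h2, h3, hH.f,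
        forall_true_left, not_true_eq_false, false_implies, and_true]
      constructor <;> (try intro u hu) <;>
        simp [Function.update_apply, hH.cnt, hH.n₁, hH.n₂, hH.mate, hH.f, hH.c₁, hH.c₂, hH.c₃, *]
    · simp only [linkProg, foundProg, wp, Op.eval, State.reg_setReg, State.arr_setReg,
        State.reg_setCell, Function.update_self, Function.update_of_ne, ne_eq, if_true, if_false,
        Nat.reduceEqDiff, not_false_eq_true, h8, h9, e1, hR.one, hR.zero, h1, h2, hH.f, lt_irrefl,
        forall_true_left, not_true_eq_false, false_implies, true_and, and_true, add_zero, hbW,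
        implies_true]
      refine ⟨by omega, ?_⟩
      constructor <;> (try intro u hu) <;>
        simp [Function.update_apply, hH.cnt, hH.n₁, hH.n₂, hH.mate, *]
    · have h3 : S.mate (I.top j) ≠ I.bot j := h2.ne'
      simp only [linkProg, joinProg, wp, State.reg_setReg, State.arr_setReg,
        State.reg_setCell, Function.update_self, Function.update_of_ne, ne_eq, if_true, if_false,
        Nat.reduceEqDiff, not_false_eq_true, h8, h9, e1, e2, hR.one, h1, h2, h2.asymm, h3, hH.f,
        forall_true_left, not_true_eq_false, false_implies, true_and, and_true]
      constructor <;> (try intro u hu) <;>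
        simp [Function.update_apply, hH.cnt, hH.n₁, hH.n₂, hH.mate, hH.f, hH.c₁, hH.c₂, hH.c₃, *]
  · simp only [linkProg, wp, hH.f, hR.one, h1, if_false, false_implies, not_false_eq_true,
      forall_true_left, true_and]
    exact hH

theorem Runs.ifLt {p q : Prog} {x y n : ℕ} {Q : State → Prop}
    (h₁ : s.reg x < s.reg y → Runs W p s n Q) (h₂ : ¬ s.reg x < s.reg y → Runs W q s n Q) :
    Runs W (.ifLt x y p q) s (n + 1) Q := by
  by_cases h : s.reg x < s.reg y
  · obtain ⟨t, s', he, ht, hQ⟩ := h₁ h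
    exact ⟨_, s', .ifTrue x y h he, by omega, hQ⟩
  · obtain ⟨t, s', he, ht, hQ⟩ := h₂ h
    exact ⟨_, s', .ifFalse x y h he, by omega, hQ⟩

theorem Runs.load_seq {p : Prog} {x A y n : ℕ} {Q : State → Prop} (hs : s.Bounded W)
    (h : (s.setReg x (s.arr A (s.reg y))).Bounded W →
      Runs W p (s.setReg x (s.arr A (s.reg y))) n Q) :
    Runs W (.seq (.load x A y) p) s (n + 1) Q := by
  have hb := hs.2 A (s.reg y)
  obtain ⟨t, s', he, ht, hQ⟩ := h (hs.setReg x hb)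
  exact ⟨_, s', .seq (.load s x A y hb) he, by omega, hQ⟩

theorem Runs.skip {n : ℕ} {Q : State → Prop} (hn : 1 ≤ n) (h : Q s) : Runs W .skip s n Q :=
  ⟨1, s, .skip s, hn, h⟩

theorem runs_ifAct {p : Prog} {j c : ℕ} {Q : State → Prop} (hj : j < I.m) (hs : s.Bounded W)
    (hR : Ready I k s) (hM : Marks I X s) (h7 : s.reg 7 = j) (hc : 1 ≤ c)
    (h : ∀ s₁, s₁.Bounded W → s₁.arr = s.arr → (∀ r, r ∉ [8, 9, 10] → s₁.reg r = s.reg r) →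
      s₁.reg 8 = I.top j → s₁.reg 9 = I.bot j →
      (I.Act X j → Runs W p s₁ c Q) ∧ (¬ I.Act X j → Q s₁)) :
    Runs W (ifAct p) s (c + 8) Q := by
  have e1 : s.arr 0 (s.reg 7) = I.top j := by rw [h7, hR.top j hj]
  have e2 : s.arr 1 (s.reg 7) = I.bot j := by rw [h7, hR.bot j hj]
  have e3 : s.arr 3 (I.bot j) < 1 ↔ I.bot j ∉ X := by rw [hM j hj]; split_ifs with h <;> simp [h]
  have hregs : ∀ r, r ∉ [8, 9, 10] → r ≠ 8 ∧ r ≠ 9 ∧ r ≠ 10 := by simp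
  unfold ifAct
  refine Runs.load_seq hs fun hb => Runs.load_seq hb fun hb => Runs.load_seq hb fun hb =>
    Runs.ifLt (n := c + 4) (fun h1 => Runs.load_seq hb fun hb => Runs.ifLt (n := c + 2)
      (fun h2 => Runs.load_seq hb fun hb => Runs.ifLt (n := c) (fun h3 => ?_) fun h3 => ?_)
      fun h2 => ?_) fun h1 => ?_ <;>
    simp only [State.reg_setReg, State.arr_setReg, Function.update_self, Function.update_of_ne, ne_eq,
      Nat.reduceEqDiff, not_false_eq_true, e1, e2, hR.one, hR.deg] at h1
  on_goal 1 => simp only [State.reg_setReg, State.arr_setReg, Function.update_self,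
    Function.update_of_ne, ne_eq, Nat.reduceEqDiff, not_false_eq_true, e1, e2, hR.one, hR.deg] at h2 h3
  on_goal 2 => simp only [State.reg_setReg, State.arr_setReg, Function.update_self,
    Function.update_of_ne, ne_eq, Nat.reduceEqDiff, not_false_eq_true, e1, e2, hR.one, hR.deg] at h2 h3
  on_goal 3 => simp only [State.reg_setReg, State.arr_setReg, Function.update_self,
    Function.update_of_ne, ne_eq, Nat.reduceEqDiff, not_false_eq_true, e1, e2, hR.one, hR.deg] at h2
  · exact (h _ hb rfl (fun r hr => by simp [hregs r hr]) (by simp [e1]) (by simp [e2])).1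
      ⟨h1, h2, e3.1 h3⟩
  · exact Runs.skip (by omega) ((h _ hb rfl (fun r hr => by simp [hregs r hr]) (by simp [e1])
      (by simp [e2])).2 fun ha => h3 (e3.2 ha.2.2))
  · exact Runs.skip (by omega) ((h _ hb rfl (fun r hr => by simp [hregs r hr]) (by simp [e1])
      (by simp [e2])).2 fun ha => h2 ha.2.1)
  · exact Runs.skip (by omega) ((h _ hb rfl (fun r hr => by simp [hregs r hr]) (by simp [e1])
      (by simp [e2])).2 fun ha => h1 ha.1)

theorem runs_clear (hs : s.Bounded W) (hR : Ready I k s) :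
    Runs W (forLoop 7 2 clearBody) s (4 * I.m + 2) (Marks I ∅) := by
  refine (Runs.for_loop (c := 2) (Inv := fun j s => ∀ i < j, s.arr 3 (I.bot i) = 0) hs hR.m hR.one
    (by decide) (by decide) (by decide) (by decide) (by decide) (by simp) ?_).mono le_rfl
    fun s' h i hi => by simp [h i hi]
  intro j s₁ hj hb hf h7 hI
  have hR := hR.of_frame hf (by decide) (by decide)
  refine (Runs.of_wp (p := clearBody) hb ?_)
  simp only [clearBody, wp, State.reg_setReg, State.arr_setReg, State.arr_setCell,
    Function.update_self, Function.update_of_ne, ne_eq, Nat.reduceEqDiff, not_false_eq_true, h7,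
    hR.bot j hj, hR.zero, Function.update_apply]
  intro i hi
  by_cases h : I.bot i = I.bot j
  · simp [h]
  · have : i ≠ j := by rintro rfl; exact h rfl
    simpa [h] using hI i (by omega)

/-- Only cells at ends of edges are reset, which keeps a scan linear in the number of edges instead
of the number of vertices. This is why `Holds` is restricted to such vertices. -/
theorem runs_reset (hs : s.Bounded W) (hR : Ready I k s) (h13 : s.reg 13 = 0) (h14 : s.reg 14 = 0)
    (h15 : s.reg 15 = 0) (h16 : s.reg 16 = 0) :
    Runs W (forLoop 7 2 resetBody) s (12 * I.m + 2) (Holds I Scan.init) := by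
  refine ((Runs.for_loop (c := 10) (Inv := fun j s => ∀ u, (∃ i < j, I.Inc u i) →
    s.arr 4 u = 0 ∧ s.arr 5 u = 0 ∧ s.arr 6 u = 0 ∧ s.arr 7 u = u) hs hR.m hR.one
    (by decide) (by decide) (by decide) (by decide) (by decide) (by simp) ?_).frame hs).mono le_rfl
    fun s' ⟨_, hf, h⟩ => ?_
  · intro j s₁ hj hb hf h7 hI
    have hR := hR.of_frame hf (by decide) (by decide)
    refine (Runs.of_wp (p := resetBody) hb ?_)
    simp only [resetBody, wp, State.reg_setReg, State.arr_setReg, State.arr_setCell, State.reg_setCell,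
      Function.update_self, Function.update_of_ne, ne_eq, Nat.reduceEqDiff, not_false_eq_true,
      h7, hR.bot j hj, hR.top j hj, Function.update_apply, hR.zero]
    intro u hu
    by_cases h1 : u = I.top j
    · simp [h1, I.disj j j hj hj]
    by_cases h2 : u = I.bot j
    · simp [h2]
    obtain ⟨i, hi, hinc⟩ := hu
    have hij : i ≠ j := by
      rintro rfl
      rcases hinc with h | h
      · exact h1 h.symm
      · exact h2 h.symm
    simpa [h1, h2] using hI u ⟨i, by omega, hinc⟩
  · refine ⟨fun u hu => (h u hu).1, fun u hu => (h u hu).2.1, fun u hu => (h u hu).2.2.1,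
      fun u hu => (h u hu).2.2.2, ?_, ?_, ?_, ?_⟩
    · rw [hf.1 13 (by decide), h13]; rfl
    · rw [hf.1 14 (by decide), h14]; rfl
    · rw [hf.1 15 (by decide), h15]; rfl
    · rw [hf.1 16 (by decide), h16]; rfl

theorem runs_degScan (hW : 2 < W) (hs : s.Bounded W) (hR : Ready I k s) (hM : Marks I X s)
    (hH : Holds I Scan.init s) :
    Runs W (forLoop 7 2 (ifAct (seq noteTopProg noteBotProg))) s (27 * I.m + 2)
      (Holds I (I.degScan X I.m)) := by
  refine Runs.for_loop (c := 25) (Inv := fun j s => Holds I (I.degScan X j) s) hs hR.m hR.one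
    (by decide) (by decide) (by decide) (by decide) (by decide) (hH.setReg (by decide)) ?_
  intro j s₁ hj hb hf h7 hI
  have hR := hR.of_frame hf (by decide) (by decide)
  have hM := hM.of_eq (hf.2 3 (by decide))
  refine (runs_ifAct (c := 17) hj hb hR hM h7 (by decide)
    fun s₂ hb₂ ha₂ hr₂ h8 h9 => ⟨fun ha => ?_, fun ha => ?_⟩)
  · have hR₂ := hR.of_eq (s' := s₂) (fun r hr => hr₂ r (by revert r; decide)) (by simp [ha₂])
    have hI₂ := hI.of_eq (s' := s₂) (fun r hr => hr₂ r (by revert r; decide)) (by simp [ha₂])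
    have hd := degInv_degScan (I := I) (X := X) hj.le
    have c1 : (I.degScan X j).cnt (I.top j) < I.m := by
      rw [hd.cnt]; exact (adeg_le j _).trans_lt hj
    refine (Runs.seq hb₂ (Runs.of_wp hb₂ (wp_noteTopProg hj hW hb₂ hR₂ hI₂ h8 h9 c1))
      fun s₃ hb₃ hf₃ hI₃ => Runs.of_wp hb₃ ?_).mono (by decide) fun s' h => h
    have hR₃ := hR₂.of_frame hf₃ (by decide) (by decide)
    have c2 : ((I.degScan X j).noteTop (I.top j) (I.bot j)).cnt (I.bot j) < I.m := by
      rw [Scan.cnt_noteTop, Function.update_of_ne (I.disj j j hj hj).symm, hd.cnt]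
      exact (adeg_le j _).trans_lt hj
    have h9₃ : s₃.reg 9 = I.bot j := by rw [hf₃.1 9 (by decide), h9]
    refine Eq.mp (congrArg _ (funext fun s' => ?_)) (wp_noteBotProg hj hW hb₃ hR₃ hI₃ h9₃ c2)
    simp only [degScan, ha, if_true]
    exact propext ⟨fun h => h.setReg (by decide), fun h => h.of_eq (by simp) (by simp)⟩
  · simp only [degScan, ha, if_false]
    exact (hI.of_eq (s' := s₂) (fun r hr => hr₂ r (by revert r; decide)) (by simp [ha₂])).setReg
      (by decide)

theorem runs_cycScan (hW : 2 < W) (hs : s.Bounded W) (hR : Ready I k s) (hM : Marks I X s)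
    (hH : Holds I (I.degScan X I.m) s) :
    Runs W (forLoop 7 2 (ifAct linkProg)) s (19 * I.m + 2) (Holds I (I.scan X)) := by
  refine Runs.for_loop (c := 17) (Inv := fun j s => Holds I (I.cycScan X j) s) hs hR.m hR.one
    (by decide) (by decide) (by decide) (by decide) (by decide) (hH.setReg (by decide)) ?_
  intro j s₁ hj hb hf h7 hI
  have hR := hR.of_frame hf (by decide) (by decide)
  have hM := hM.of_eq (hf.2 3 (by decide))
  refine (runs_ifAct (c := 9) hj hb hR hM h7 (by decide)
    fun s₂ hb₂ ha₂ hr₂ h8 h9 => ⟨fun ha => ?_, fun ha => ?_⟩)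
  · have hR₂ := hR.of_eq (s' := s₂) (fun r hr => hr₂ r (by revert r; decide)) (by simp [ha₂])
    have hI₂ := hI.of_eq (s' := s₂) (fun r hr => hr₂ r (by revert r; decide)) (by simp [ha₂])
    refine (Runs.of_wp hb₂ (wp_linkProg hj hW hb₂ hR₂ hI₂ h8 h9)).mono (by decide) fun s' h => ?_
    simp only [cycScan, ha, if_true]
    exact h.setReg (by decide)
  · simp only [cycScan, ha, if_false]
    exact (hI.of_eq (s' := s₂) (fun r hr => hr₂ r (by revert r; decide)) (by simp [ha₂])).setReg
      (by decide)

theorem runs_scan (hW : 2 < W) (hs : s.Bounded W) (hR : Ready I k s) (hM : Marks I X s) :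
    Runs W scanProg s (58 * I.m + 10) (Holds I (I.scan X)) := by
  refine (Runs.seq (n₁ := 4) (n₂ := 58 * I.m + 6) hs (Runs.of_wp (Q := fun s' => s'.reg 13 = 0 ∧
    s'.reg 14 = 0 ∧ s'.reg 15 = 0 ∧ s'.reg 16 = 0) hs ?_) fun s₁ hb₁ hf₁ h₁ => ?_).mono
    (by omega) fun _ h => h
  · simp [wp, Function.update_apply]
    omega
  have hR₁ := hR.of_frame hf₁ (by decide) (by decide)
  have hM₁ := hM.of_eq (hf₁.2 3 (by decide))
  refine (Runs.seq hb₁ (runs_reset hb₁ hR₁ h₁.1 h₁.2.1 h₁.2.2.1 h₁.2.2.2)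
    (n₂ := 46 * I.m + 4) fun s₂ hb₂ hf₂ h₂ => ?_).mono (by omega) fun _ h => h
  have hR₂ := hR₁.of_frame hf₂ (by decide) (by decide)
  have hM₂ := hM₁.of_eq (hf₂.2 3 (by decide))
  refine (Runs.seq hb₂ (runs_degScan hW hb₂ hR₂ hM₂ h₂)
    (n₂ := 19 * I.m + 2) fun s₃ hb₃ hf₃ h₃ => ?_).mono (by omega) fun _ h => h
  have hR₃ := hR₂.of_frame hf₃ (by decide) (by decide)
  have hM₃ := hM₂.of_eq (hf₃.2 3 (by decide))
  exact runs_cycScan hW hb₃ hR₃ hM₃ h₃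

theorem Marks.insert {c : ℕ} (h : Marks I X s) (hA : s'.arr 3 = Function.update (s.arr 3) c 1) :
    Marks I (insert c X) s' := by
  intro i hi
  rw [hA, Function.update_apply, h i hi]
  by_cases h1 : I.bot i = c <;> simp [h1]

/-- One step of `chosen` on the marked set, with success recorded when the scan reports no conflict.
-/
theorem wp_chooseProg {r : ℕ} (hW : 2 < W) (hR : Ready I k s)
    (hM : Marks I (I.chosen (s.arr 8) r) s) (hH : Holds I (I.scan (I.chosen (s.arr 8) r)) s)
    (h17 : s.reg 17 = r) :
    chooseProg.wp W s fun s' => Marks I (I.chosen (s.arr 8) (r + 1)) s' ∧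
      (s'.reg 18 = 1 ↔ s.reg 18 = 1 ∨ (I.scan (I.chosen (s.arr 8) r)).f = 0) := by
  rw [chosen]
  generalize I.chosen (s.arr 8) r = X at *
  have h13 := hH.f
  by_cases h1 : (I.scan X).f = 0
  · simp [chooseProg, wp, h13, h1, hR.one]
    exact ⟨by omega, hM.of_eq rfl⟩
  · have h1' : ¬ (I.scan X).f < 1 := by omega
    by_cases h2 : s.arr 8 r < 1
    · simp only [chooseProg, wp, h13, h1', h1, hR.one, h17, h2, State.reg_setReg, State.arr_setReg,
        Function.update_self, Function.update_of_ne, ne_eq, Nat.reduceEqDiff, not_false_eq_true,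
        if_true, if_false, false_implies, forall_true_left, not_true_eq_false, true_and, and_true,
        State.reg_setCell, State.arr_setCell, hH.c₁, or_false]
      exact hM.insert (by simp)
    · by_cases h3 : s.arr 8 r < 2
      · simp only [chooseProg, wp, h13, h1', h1, hR.one, hR.two, h17, h2, h3, State.reg_setReg,
          State.arr_setReg,
          Function.update_self, Function.update_of_ne, ne_eq, Nat.reduceEqDiff, not_false_eq_true,
          if_true, if_false, false_implies, forall_true_left, not_true_eq_false, true_and, and_true,
          State.reg_setCell, State.arr_setCell, hH.c₂, or_false]
        exact hM.insert (by simp)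
      · simp only [chooseProg, wp, h13, h1', h1, hR.one, hR.two, h17, h2, h3, State.reg_setReg,
          State.arr_setReg,
          Function.update_self, Function.update_of_ne, ne_eq, Nat.reduceEqDiff, not_false_eq_true,
          if_true, if_false, false_implies, forall_true_left, not_true_eq_false, true_and, and_true,
          State.reg_setCell, State.arr_setCell, hH.c₃, or_false]
        exact hM.insert (by simp)

theorem runs_search (hW : 2 < W) (hs : s.Bounded W) (hR : Ready I k s) (hM : Marks I ∅ s)
    (h19 : s.reg 19 = k + 1) :
    Runs W searchProg s ((58 * I.m + 17) * (k + 1) + 2) fun s' =>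
      (s'.reg 18 = 1 ↔ s.reg 18 = 1 ∨ I.Accepts (s.arr 8) k) := by
  -- The depths `0, …, k` need `k + 1` scans. A vertex marked after the last of them has no effect
  -- on the success flag.
  have key := Runs.for_loop (W := W) (s := s) (x := 17) (y := 19) (p := seq scanProg chooseProg)
    (c := 58 * I.m + 15) (Inv := fun r s' => Marks I (I.chosen (s.arr 8) r) s' ∧
      (s'.reg 18 = 1 ↔ s.reg 18 = 1 ∨ ∃ r' < r, (I.scan (I.chosen (s.arr 8) r')).f = 0)) hs h19 hR.one
    (by decide) (by decide) (by decide) (by decide) (by decide)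
    (by simpa [chosen] using hM.of_eq (s' := s.setReg 17 0) rfl)
  refine (key ?_).mono le_rfl fun s' h => ?_
  · rintro j s₁ hj hb hf h17 ⟨hM₁, hacc⟩
    have hR₁ := hR.of_frame hf (by decide) (by decide)
    have h8 : s₁.arr 8 = s.arr 8 := hf.2 8 (by decide)
    refine (Runs.seq hb (runs_scan hW hb hR₁ hM₁) (n₂ := 5) fun s₂ hb₂ hf₂ hH₂ => ?_).mono
      (by omega) fun _ h => h
    have hR₂ := hR₁.of_frame hf₂ (by decide) (by decide)
    have h8₂ : s₂.arr 8 = s.arr 8 := (hf₂.2 8 (by decide)).trans h8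
    have hM₂ := hM₁.of_eq (hf₂.2 3 (by decide))
    have h17₂ : s₂.reg 17 = j := (hf₂.1 17 (by decide)).trans h17
    rw [← h8₂] at hM₂ hH₂
    refine (Runs.of_wp hb₂ (wp_chooseProg hW hR₂ hM₂ hH₂ h17₂)).mono (by decide) fun s' h => ?_
    rw [h8₂, hf₂.1 18 (by decide)] at h
    refine ⟨h.1.of_eq rfl, ?_⟩
    rw [State.reg_setReg, Function.update_of_ne (by decide), h.2, hacc, or_assoc]
    refine or_congr_right ⟨?_, ?_⟩
    · rintro (⟨r', hr', h⟩ | h)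
      · exact ⟨r', by omega, h⟩
      · exact ⟨j, by omega, h⟩
    · rintro ⟨r', hr', hf'⟩
      rcases Nat.lt_succ_iff_lt_or_eq.1 hr' with hr' | rfl
      · exact .inl ⟨r', hr', hf'⟩
      · exact .inr hf'
  · rw [h.2]
    simp only [Accepts, Nat.lt_succ_iff]

/-! ### Enumeration of the sequences of choices -/

/-- The number with the digits `d 0, …, d (k - 1)` in base three. -/
def ternary (d : ℕ → ℕ) (k : ℕ) : ℕ := ∑ i ∈ Finset.range k, d i * 3 ^ i

theorem ternary_lt {d : ℕ → ℕ} (hd : ∀ i, d i < 3) (k : ℕ) : ternary d k < 3 ^ k := by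
  induction k with
  | zero => simp [ternary]
  | succ k ih =>
    rw [ternary, Finset.sum_range_succ, ← ternary, pow_succ]
    have : d k * 3 ^ k ≤ 2 * 3 ^ k := Nat.mul_le_mul_right _ (by have := hd k; omega)
    omega

/-- Base-three representations are unique: the top digit outweighs all lower ones. So counting
upwards meets every sequence of choices, up to digits that `Accepts` ignores. -/
theorem ternary_inj {d d' : ℕ → ℕ} (hd : ∀ i, d i < 3) (hd' : ∀ i, d' i < 3) {k : ℕ}
    (h : ternary d k = ternary d' k) : ∀ i < k, d i = d' i := by
  induction k with
  | zero => intro i hi; omega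
  | succ k ih =>
    have h1 := ternary_lt hd k
    have h2 := ternary_lt hd' k
    simp only [ternary, Finset.sum_range_succ] at h
    rw [← ternary, ← ternary] at h
    have e : d k = d' k := by
      rcases lt_trichotomy (d k) (d' k) with hlt | heq | hlt
      · have : (d k + 1) * 3 ^ k ≤ d' k * 3 ^ k := Nat.mul_le_mul_right _ hlt
        rw [add_mul] at this
        omega
      · exact heq
      · have : (d' k + 1) * 3 ^ k ≤ d k * 3 ^ k := Nat.mul_le_mul_right _ hlt
        rw [add_mul] at this
        omega
    rw [e] at h
    intro i hi
    rcases Nat.lt_succ_iff_lt_or_eq.1 hi with hi | rfl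
    · exact ih (by omega) i hi
    · exact e

theorem ternary_update (d : ℕ → ℕ) {j k : ℕ} (hj : j < k) (x : ℕ) :
    ternary (Function.update d j x) k + d j * 3 ^ j = ternary d k + x * 3 ^ j := by
  have hj' : j ∈ Finset.range k := Finset.mem_range.2 hj
  unfold ternary
  rw [← Finset.add_sum_erase _ _ hj', ← Finset.add_sum_erase _ (fun i => d i * 3 ^ i) hj']
  have : ∑ i ∈ (Finset.range k).erase j, Function.update d j x i * 3 ^ i =
      ∑ i ∈ (Finset.range k).erase j, d i * 3 ^ i :=
    Finset.sum_congr rfl fun i hi => by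
      rw [Function.update_of_ne (Finset.ne_of_mem_erase hi)]
  rw [this, Function.update_self]
  ring

/-- The invariant of the addition of `1` to the number `v` with the digits in array `8`. -/
structure Carry (k v j : ℕ) (s : State) : Prop where
  lt : ∀ i, s.arr 8 i < 3
  le : s.reg 20 ≤ 1
  val : s.reg 20 * 3 ^ j + ternary (s.arr 8) k = v + 1
  zero : s.reg 20 = 1 → ∀ i < j, s.arr 8 i = 0

theorem runs_next (hW : 2 < W) (hs : s.Bounded W) (hR : Ready I k s) (hd : ∀ i, s.arr 8 i < 3) :
    Runs W nextProg s (9 * k + 4) fun s' => (∀ i, s'.arr 8 i < 3) ∧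
      (s'.reg 21 = 1 ∧ ternary (s'.arr 8) k = ternary (s.arr 8) k + 1 ∨
        s'.reg 21 = 0 ∧ 3 ^ k = ternary (s.arr 8) k + 1) := by
  refine (Runs.seq hs (Runs.of_wp (Q := Carry k (ternary (s.arr 8) k) 0) hs ?_) (n₂ := 9 * k + 3)
    fun s₁ hb₁ hf₁ h₁ => ?_).mono (by simp only [cost]; omega) fun _ h => h
  · refine ⟨by omega, ?_, ?_, ?_, ?_⟩ <;> simp [hd, add_comm]
  have hR₁ := hR.of_frame hf₁ (by decide) (by decide)
  refine (Runs.seq hb₁ (n₁ := 9 * k + 2) (n₂ := 1) (Runs.for_loop (c := 7)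
    (Inv := Carry k (ternary (s.arr 8) k)) hb₁ hR₁.k hR₁.one
    (by decide) (by decide) (by decide) (by decide) (by decide) ?_ ?_) fun s₂ hb₂ hf₂ h₂ => ?_)
  · exact ⟨h₁.lt, h₁.le, h₁.val, h₁.zero⟩
  · intro j s₂ hj hb₂ hf₂ h7 h₂
    have hR₂ := hR₁.of_frame hf₂ (by decide) (by decide)
    have hle := h₂.le
    refine (Runs.of_wp (p := nextBody) hb₂ ?_).mono (by decide) fun _ h => h
    have hup := ternary_update (s₂.arr 8) hj
    have hval := h₂.val
    rcases Nat.le_one_iff_eq_zero_or_eq_one.1 hle with h0 | h0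
    · simp only [nextBody, wp, h0, hR₂.zero, State.reg_setReg, Function.update_of_ne, ne_eq,
        Nat.reduceEqDiff, not_false_eq_true, lt_irrefl, false_implies, forall_true_left, true_and]
      refine ⟨h₂.lt, h₂.le, ?_, ?_⟩
      · simp only [State.reg_setReg, State.arr_setReg, Function.update_of_ne, ne_eq,
          Nat.reduceEqDiff, not_false_eq_true, h0] at hval ⊢
        omega
      · simp [h0]
    · by_cases h1 : s₂.arr 8 j < 2
      · simp only [nextBody, wp, Op.eval, h0, hR₂.zero, hR₂.one, hR₂.two, h7, h1, State.reg_setReg,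
          State.arr_setReg, State.reg_setCell, Function.update_self, Function.update_of_ne, ne_eq,
          Nat.reduceEqDiff, not_false_eq_true, zero_lt_one, forall_true_left, not_true_eq_false,
          false_implies, and_true]
        refine ⟨fun _ => by omega, by omega, fun i => ?_, ?_, ?_, ?_⟩
        · have := h₂.lt i
          simp only [State.arr_setReg, State.arr_setCell, Function.update_self,
            Function.update_apply (s₂.arr 8)]
          split_ifs <;> omega
        · simp
        · have := hup (s₂.arr 8 j + 1)
          rw [h0] at hval
          simp
          rw [add_mul] at this
          omega
        · simp
      · have h1' : s₂.arr 8 j = 2 := by have := h₂.lt j; omega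
        simp only [nextBody, wp, Op.eval, h0, hR₂.zero, hR₂.one, hR₂.two, h7, h1, State.reg_setReg,
          State.arr_setReg, State.reg_setCell, Function.update_self, Function.update_of_ne, ne_eq,
          Nat.reduceEqDiff, not_false_eq_true, zero_lt_one, forall_true_left, not_true_eq_false,
          false_implies, and_true, true_and]
        refine ⟨fun i => ?_, ?_, ?_, fun _ i hi => ?_⟩
        · have := h₂.lt i
          simp only [State.arr_setReg, State.arr_setCell, Function.update_self,
            Function.update_apply (s₂.arr 8)]
          split_ifs <;> omega
        · simp [h0]
        -- Clearing a digit `2` loses `2 * 3 ^ j`, and moving the carry up gains exactly that: `3 ^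
        -- (j + 1) = 3 ^ j + 2 * 3 ^ j`.
        · have := hup 0
          rw [h0] at hval
          rw [h1'] at this
          simp [h0, pow_succ]
          omega
        · have := h₂.zero h0 i
          simp only [State.arr_setReg, State.arr_setCell, Function.update_self,
            Function.update_apply (s₂.arr 8)]
          split_ifs
          · rfl
          · exact this (by omega)
  · have hR₂ := hR₁.of_frame hf₂ (by decide) (by decide)
    refine Runs.of_wp hb₂ ⟨fun hb => ?_, h₂.lt, ?_⟩
    · simp only [Op.eval, hR₂.one]
      omega
    · have hval := h₂.val
      rcases Nat.le_one_iff_eq_zero_or_eq_one.1 h₂.le with h0 | h0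
      · left
        simp only [Op.eval, hR₂.one, h0, State.reg_setReg, State.arr_setReg, Function.update_self,
          true_and, Nat.sub_zero]
        rw [h0] at hval
        omega
      · right
        -- A surviving carry means that all digits were `2`, so the last sequence has just been
        -- tried.
        have hz : ternary (s₂.arr 8) k = 0 :=
          Finset.sum_eq_zero fun i hi => by rw [h₂.zero h0 i (Finset.mem_range.1 hi), zero_mul]
        simp only [Op.eval, hR₂.one, h0, State.reg_setReg, Function.update_self, true_and, Nat.sub_self]
        rw [h0, hz] at hval
        omega

end BipartiteSplit

namespace BipartiteSplit

/-! ### Correctness and running time of the whole program -/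

open Prog EdgeList

variable {W k a b : ℕ} {I : EdgeList} {s : State} {l : List (Fin a × Fin b)}

theorem inputState_bounded (ha : a < W) (hb : b < W) (hm : l.length < W) (hk : k < W) :
    (inputState l k).Bounded W := by
  have h0 : 0 < W := by omega
  refine ⟨fun r => ?_, fun A i => ?_⟩
  · match r with
    | 0 => exact ha
    | 1 => exact hb
    | 2 => exact hm
    | 3 => exact hk
    | _ + 4 => exact h0
  · match A with
    | 0 =>
      simp only [inputState, List.getD_eq_getElem?_getD, List.getElem?_map]
      cases h : l[i]? with
      | none => simpa using h0
      | some e => simpa using e.1.isLt.trans ha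
    | 1 =>
      simp only [inputState, List.getD_eq_getElem?_getD, List.getElem?_map]
      cases h : l[i]? with
      | none => simpa using h0
      | some e => simpa using e.2.isLt.trans hb
    | _ + 2 => exact h0

theorem runs_init (hl : l.Nodup) (hW : 2 < W) (hab : a + b < W)
    (hs : (inputState l k).Bounded W) :
    Runs W initProg (inputState l k) (12 * l.length + 5) (Ready (ofList l hl) k) := by
  set I := ofList l hl with hI
  have hb : ∀ j < l.length, I.bot j = a + (inputState l k).arr 1 j := fun j hj => rfl
  refine (Runs.seq (n₁ := 3) hs (Runs.of_wp (Q := fun s' => s'.reg 4 = 0 ∧ s'.reg 5 = 1 ∧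
    s'.reg 6 = 2) hs ?_) (n₂ := 12 * l.length + 2) fun s₁ hb₁ hf₁ h₁ => ?_).mono (by omega) fun _ h => h
  · simp [wp, Function.update_apply]
    omega
  -- After `j` rounds exactly the first `j` bottom ends are shifted by `a`, making their numbers
  -- disjoint from those of the top vertices, and array `2` holds the degrees in the first `j`
  -- edges.
  have key := Runs.for_loop (W := W) (s := s₁) (x := 7) (y := 2) (p := initBody)
    (c := 10) (Inv := fun j s' => (∀ i < I.m, s'.arr 1 i = if i < j then I.bot i else
      (inputState l k).arr 1 i) ∧ ∀ u, s'.arr 2 u = ((Finset.range j).filter (I.Inc u)).card) hb₁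
    (hf₁.1 2 (by decide)) h₁.2.1
    (by decide) (by decide) (by decide) (by decide) (by decide)
    (by
      rw [State.arr_setReg, hf₁.2 1 (by decide), hf₁.2 2 (by decide)]
      simp [inputState]) ?_
  · refine (key.frame hb₁).mono (by exact le_of_eq (by rfl)) fun s' ⟨_, hf, h⟩ => ?_
    refine ⟨(hf.1 2 (by decide)).trans (hf₁.1 2 (by decide)),
      (hf.1 3 (by decide)).trans (hf₁.1 3 (by decide)), (hf.1 4 (by decide)).trans h₁.1,
      (hf.1 5 (by decide)).trans h₁.2.1, (hf.1 6 (by decide)).trans h₁.2.2,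
      fun i hi => by rw [hf.2 0 (by decide), hf₁.2 0 (by decide)]; rfl,
      fun i hi => ?_, h.2⟩
    rw [h.1 i hi, if_pos (by exact hi)]
  · rintro j s₂ hj hb₂ hf₂ h7 ⟨h1, h2⟩
    have hj : j < I.m := hj
    have e0 : s₂.reg 0 = a := (hf₂.1 0 (by decide)).trans (hf₁.1 0 (by decide))
    have e1 : s₂.arr 0 j = I.top j := by rw [hf₂.2 0 (by decide), hf₁.2 0 (by decide)]; rfl
    have e2 : s₂.arr 1 j = (inputState l k).arr 1 j := by rw [h1 j hj, if_neg (lt_irrefl _)]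
    have e3 : a + (inputState l k).arr 1 j = I.bot j := rfl
    have e4 : (inputState l k).arr 1 j < b := by
      have h := (ofList_edge hl hj).2
      have h' := l[j].2.isLt
      rw [← hI, ← e3] at h
      omega
    have e5 : s₂.reg 5 = 1 := (hf₂.1 5 (by decide)).trans h₁.2.1
    have hmW : I.m < W := by
      have := hs.1 2
      exact this
    have hne := I.disj j j hj hj
    have hcard : ∀ u, ((Finset.range j).filter (I.Inc u)).card ≤ j := fun u => by
      simpa using Finset.card_filter_le (Finset.range j) (I.Inc u)
    have hsucc : ∀ u, ((Finset.range (j + 1)).filter (I.Inc u)).card =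
        ((Finset.range j).filter (I.Inc u)).card + if u = I.top j ∨ u = I.bot j then 1 else 0 := by
      intro u
      rw [Finset.range_add_one, Finset.filter_insert]
      have : I.Inc u j ↔ u = I.top j ∨ u = I.bot j := by
        rw [eq_comm, @eq_comm _ u]; rfl
      simp only [← this]
      split_ifs
      · rw [Finset.card_insert_of_notMem (by simp)]
      · rfl
    refine (Runs.of_wp (p := initBody) hb₂ ?_).mono (by decide) fun _ h => h
    simp only [initBody, wp, Op.eval, State.reg_setReg, State.arr_setReg, State.reg_setCell,
      State.arr_setCell, Function.update_self, Function.update_of_ne, ne_eq, Nat.reduceEqDiff,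
      not_false_eq_true, h7, e0, e1, e2, e3, e5, h2, hne.symm]
    refine ⟨fun _ => by omega, fun _ => ?_, fun _ => ?_, fun i hi => ?_, fun u => ?_⟩
    · have := hcard (I.top j)
      omega
    · have := hcard (I.bot j)
      omega
    · rw [Function.update_apply, h1 i hi]
      by_cases h : i = j
      · simp [h]
      · simp only [h, if_false]
        congr 1
        exact propext ⟨fun h => by omega, fun h => by omega⟩
    · rw [hsucc]
      by_cases hu : u = I.top j
      · simp [hu, hne]
      · by_cases hu' : u = I.bot j <;> simp [hu, hu', h2, hne.symm]

/-- The invariant of the enumeration. -/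
structure Enum (I : EdgeList) (k : ℕ) (s : State) : Prop where
  ready : Ready I k s
  lt : ∀ i, s.arr 8 i < 3
  bound : s.reg 19 = k + 1
  running : s.reg 21 = 0 ∨ s.reg 21 = 1 ∧ (s.reg 18 = 1 ↔
    ∃ d : ℕ → ℕ, (∀ i, d i < 3) ∧ ternary d k < ternary (s.arr 8) k ∧ I.Accepts d k)
  done : s.reg 21 = 0 → (s.reg 18 = 1 ↔ ∃ d : ℕ → ℕ, (∀ i, d i < 3) ∧ I.Accepts d k)

theorem exists_lt_ternary_succ {d : ℕ → ℕ} (hd : ∀ i, d i < 3) {n : ℕ} (hn : n = ternary d k + 1) :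
    (∃ d' : ℕ → ℕ, (∀ i, d' i < 3) ∧ ternary d' k < n ∧ I.Accepts d' k) ↔
      (∃ d' : ℕ → ℕ, (∀ i, d' i < 3) ∧ ternary d' k < ternary d k ∧ I.Accepts d' k) ∨
        I.Accepts d k := by
  constructor
  · rintro ⟨d', hd', hlt, ha⟩
    rcases Nat.lt_succ_iff_lt_or_eq.1 (hn ▸ hlt) with h | h
    · exact .inl ⟨d', hd', h, ha⟩
    · exact .inr ((accepts_congr (ternary_inj hd' hd h)).1 ha)
  · rintro (⟨d', hd', hlt, ha⟩ | ha)
    · exact ⟨d', hd', by omega, ha⟩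
    · exact ⟨d, hd, by omega, ha⟩

theorem runs_enum (hW : 2 < W) (hs : s.Bounded W) (h : Enum I k s) (h21 : s.reg 21 = 1) :
    Runs W (seq (forLoop 7 2 clearBody) <| seq searchProg nextProg) s
      (4 * I.m + (58 * I.m + 17) * (k + 1) + 9 * k + 8) fun s' => Enum I k s' ∧
        (s'.reg 21 = 0 ∨ ternary (s'.arr 8) k = ternary (s.arr 8) k + 1) := by
  obtain ⟨hR, hd, h19, hrun, -⟩ := h
  have hrun := (hrun.resolve_left (by omega)).2
  refine (Runs.seq hs (runs_clear hs hR) (n₂ := (58 * I.m + 17) * (k + 1) + 9 * k + 6)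
    fun s₁ hb₁ hf₁ hM₁ => ?_).mono (by omega) fun _ h => h
  have hR₁ := hR.of_frame hf₁ (by decide) (by decide)
  refine (Runs.seq hb₁ (runs_search hW hb₁ hR₁ hM₁ ((hf₁.1 19 (by decide)).trans h19))
    (n₂ := 9 * k + 4) fun s₂ hb₂ hf₂ hacc => ?_).mono (by omega) fun _ h => h
  have hR₂ := hR₁.of_frame hf₂ (by decide) (by decide)
  have e8 : s₂.arr 8 = s.arr 8 := (hf₂.2 8 (by decide)).trans (hf₁.2 8 (by decide))
  rw [hf₁.1 18 (by decide), hf₁.2 8 (by decide), hrun] at hacc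
  refine ((runs_next hW hb₂ hR₂ (by rwa [e8])).frame hb₂).mono le_rfl
    fun s₃ ⟨_, hf₃, hd₃, h₃⟩ => ?_
  rw [e8] at h₃
  have e18 : s₃.reg 18 = s₂.reg 18 := hf₃.1 18 (by decide)
  refine ⟨⟨hR₂.of_frame hf₃ (by decide) (by decide), hd₃, ?_, ?_, fun h0 => ?_⟩, ?_⟩
  · rw [hf₃.1 19 (by decide), hf₂.1 19 (by decide), hf₁.1 19 (by decide), h19]
  · rcases h₃ with ⟨h1, h2⟩ | ⟨h1, -⟩
    · exact .inr ⟨h1, by rw [e18, hacc, exists_lt_ternary_succ hd h2]⟩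
    · exact .inl h1
  -- At overflow the bound on the codes already tried is `3 ^ k`, which every code satisfies; so all
  -- sequences have been tried.
  · have h3 := (h₃.resolve_left (by omega)).2
    rw [e18, hacc, ← exists_lt_ternary_succ hd h3]
    exact exists_congr fun d => ⟨fun h => ⟨h.1, h.2.2⟩, fun h => ⟨h.1, ternary_lt h.1 k, h.2⟩⟩
  · exact h₃.symm.imp And.left And.right

theorem runs_crsv (hl : l.Nodup) (hW : 2 < W) (hab : a + b < W) (hk : k + 1 < W)
    (hs : (inputState l k).Bounded W) :
    Runs W crsvProg (inputState l k) (12 * l.length + 10 +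
      (4 * l.length + (58 * l.length + 17) * (k + 1) + 9 * k + 9) * 3 ^ k) fun s' =>
        (s'.reg 0 = 1 ↔ ∃ d : ℕ → ℕ, (∀ i, d i < 3) ∧ (ofList l hl).Accepts d k) := by
  set I := ofList l hl with hI
  have hm : I.m = l.length := rfl
  rw [← hm]
  set c := 4 * I.m + (58 * I.m + 17) * (k + 1) + 9 * k + 8 with hc
  rw [show 4 * I.m + (58 * I.m + 17) * (k + 1) + 9 * k + 9 = c + 1 from rfl]
  refine (Runs.seq hs (runs_init hl hW hab hs) (n₂ := (c + 1) * 3 ^ k + 5)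
    fun s₁ hb₁ hf₁ hR₁ => ?_).mono (by omega) fun _ h => h
  have h8 : ∀ i, s₁.arr 8 i = 0 := fun i => by rw [hf₁.2 8 (by decide)]; rfl
  have ht : ∀ {s' : State}, (∀ i, s'.arr 8 i = 0) → ternary (s'.arr 8) k = 0 := fun h =>
    Finset.sum_eq_zero fun i _ => by rw [h i, zero_mul]
  refine (Runs.seq hb₁ (n₁ := 3) (Runs.of_wp (Q := fun s' => Enum I k s' ∧ s'.reg 21 = 1 ∧
    ∀ i, s'.arr 8 i = 0) hb₁ ?_) (n₂ := (c + 1) * 3 ^ k + 2) fun s₂ hb₂ hf₂ ⟨hE, h21, h8₂⟩ =>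
      ?_).mono (by omega) fun _ h => h
  · refine ⟨by omega, by omega, fun _ => ?_, ⟨?_, ?_, ?_, ?_, ?_⟩, ?_, ?_⟩
    · simp [Op.eval, hR₁.k, hR₁.one]
      omega
    · exact hR₁.of_eq (by simp) (by simp)
    · simp [h8]
    · simp [Op.eval, hR₁.k, hR₁.one]
    · right
      simp only [State.arr_setReg, ht h8]
      simp
    · simp
    · simp
    · simp [h8]
  -- The measure is the number of codes not yet tried, set to zero once the continuation flag is
  -- cleared.
  refine (Runs.seq hb₂ (n₁ := (c + 1) * 3 ^ k + 1) (n₂ := 1) ((Runs.while_loop (c := c)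
    (Inv := Enum I k) (fun s => if s.reg 21 = 0 then 0 else 3 ^ k - ternary (s.arr 8) k) hb₂ hE
    fun s₃ hb₃ hf₃ hE₃ hlt => ?_).mono ?_ fun _ h => h) fun s₃ hb₃ hf₃ ⟨hE₃, hlt⟩ => ?_)
  · rw [hE₃.ready.zero] at hlt
    have h1 := (hE₃.running.resolve_left (by omega)).1
    refine (runs_enum hW hb₃ hE₃ h1).mono le_rfl fun s₄ ⟨hE₄, h⟩ => ⟨hE₄, ?_⟩
    have h2 := ternary_lt hE₃.lt k
    simp only [h1, one_ne_zero, if_false]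
    generalize 3 ^ k = K at h2 ⊢
    rcases h with h | h
    · rw [if_pos h]
      omega
    · split_ifs <;> omega
  · simp [h21, ht h8₂]
  · rw [hE₃.ready.zero] at hlt
    have h := hE₃.done (by omega)
    refine Runs.of_wp hb₃ ⟨fun hb => ?_, ?_⟩
    · have := hb.1 18
      simpa [Op.eval, hE₃.ready.zero] using this
    · simpa [Op.eval, hE₃.ready.zero] using h

/-- The constant `100` is `12 + 88`, from the initialization and from the enumeration; `(k + 1) * 3
^ k ≤ 2 ^ (3 * k)` is far below the permitted exponential. -/
theorem steps_le (m k : ℕ) : 12 * m + 10 + (4 * m + (58 * m + 17) * (k + 1) + 9 * k + 9) * 3 ^ k ≤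
    100 * 2 ^ (100 * k ^ 6) * (m + 1) := by
  have h1 : k + 1 ≤ 2 ^ k := Nat.lt_two_pow_self
  have h2 : 3 ^ k ≤ 2 ^ (2 * k) := by
    rw [pow_mul]
    exact Nat.pow_le_pow_left (by norm_num) k
  have h3 : k ≤ k ^ 6 := Nat.le_self_pow (by norm_num) k
  have h4 : 2 ^ k * 2 ^ (2 * k) ≤ 2 ^ (100 * k ^ 6) := by
    rw [← pow_add]
    exact Nat.pow_le_pow_right (by norm_num) (by omega)
  have h5 : 4 * m + (58 * m + 17) * (k + 1) + 9 * k + 9 ≤ 88 * (m + 1) * (k + 1) := by nlinarith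
  have h6 : 12 * m + 10 ≤ 12 * (m + 1) * (2 ^ (100 * k ^ 6)) :=
    le_trans (by omega) (Nat.le_mul_of_pos_right _ (by positivity))
  calc _ ≤ 12 * (m + 1) * (2 ^ (100 * k ^ 6)) + 88 * (m + 1) * (2 ^ k) * 2 ^ (2 * k) := by
        gcongr; exact h5.trans (by gcongr)
    _ = 12 * (m + 1) * (2 ^ (100 * k ^ 6)) + 88 * (m + 1) * (2 ^ k * 2 ^ (2 * k)) := by ring
    _ ≤ 12 * (m + 1) * (2 ^ (100 * k ^ 6)) + 88 * (m + 1) * 2 ^ (100 * k ^ 6) := by gcongr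
    _ = _ := by ring

end BipartiteSplit

theorem theorem1 :
    ∃ (P : BipartiteSplit.Prog) (C : ℕ),
      ∀ (a b k : ℕ) (G : Finset (Fin a × Fin b)) (l : List (Fin a × Fin b)),
        l.Nodup → l.toFinset = G →
        ∃ (t : ℕ) (s : BipartiteSplit.State),
          BipartiteSplit.Exec (C * (a + b + G.card + k + 1) ^ C) P
            (BipartiteSplit.inputState l k) t s ∧
          t ≤ C * 2 ^ (C * k ^ 6) * (G.card + 1) ∧
          (s.reg 0 = 1 ↔ BipartiteSplit.CRSV (G : Set (Fin a × Fin b)) k) := by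
  refine ⟨BipartiteSplit.crsvProg, 100, ?_⟩
  rintro a b k G l hl rfl
  have hcard : l.toFinset.card = l.length := List.toFinset_card_of_nodup hl
  have hG : ((l.toFinset : Finset (Fin a × Fin b)) : Set (Fin a × Fin b)) = {e | e ∈ l} := by
    ext e
    simp
  rw [hcard, hG, BipartiteSplit.EdgeList.crsv_iff hl, ← BipartiteSplit.EdgeList.exists_accepts_iff]
  -- For the word size only linearity matters: `100 * N` exceeds `2`, `a + b`, `k + 1` and the
  -- number of edges.
  have hN := Nat.le_self_pow (n := 100) (by norm_num) (a + b + l.length + k + 1)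
  generalize (a + b + l.length + k + 1) ^ 100 = N at hN
  obtain ⟨t, s, he, ht, hs⟩ := BipartiteSplit.runs_crsv (W := 100 * N) (k := k) hl (by omega)
    (by omega) (by omega)
    (BipartiteSplit.inputState_bounded (by omega) (by omega) (by omega) (by omega))
  exact ⟨t, s, he, ht.trans (BipartiteSplit.steps_le _ _), hs⟩
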